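/- Let $K$ be a local field of characteristic $p$ with finite residue field $k$, $|k| = q$, and let $K_s$ be a separable closure of $K$. For a totally ramified subextension $L/K$ of $K_s/K$ of degree $p$, let $\nu_L$ be the valuation of $K_s$ normalized so that $\nu_L(L^\times)=\mathbb{Z}$; $b$ is the ramification break of $L/K$ if $b=\nu_L(\sigma(\pi_L)-\pi_L)-1$ for some prime element $\pi_L$ of $L$ and some $K$-embedding $\sigma : L\to K_s$ other than the inclusion. Two subextensions $L_1/K$ and $L_2/K$ of $K_s/K$ are called $k$-isomorphic if there is a field isomorphism $\sigma : L_1\to L_2$ such that $\sigma(K)=K$ and $\sigma$ induces the identity map on $k$. For rational $b$ let $\mathcal{E}_b$ be the set of totally ramified subextensions of $K_s/K$ of degree $p$ with ramification break $b$, and let $\mathcal{S}_b$, $\mathcal{S}_b^{g}$, $\mathcal{S}_b^{ng}$ be the sets of $k$-isomorphism classes of, respectively, all extensions, the Galois extensions, and the non-Galois extensions in $\mathcal{E}_b$. Let $b\in\frac{1}{p-1}\cdot(\mathbb{N}\smallsetminus p\mathbb{N})$. Then $$|\mathcal{S}_b| = \gcd(q-1,\,(p-1)b).$$ Furthermore,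 if $b\in\mathbb{N}\smallsetminus p\mathbb{N}$, then $$|\mathcal{S}_b^{g}| = \gcd\left(\frac{q-1}{p-1},\,b\right),\qquad |\mathcal{S}_b^{ng}| = (p-2)\cdot\gcd\left(\frac{q-1}{p-1},\,b\right).$$ -/

import Mathlib

open scoped ValuativeRel

namespace LocalFieldExt

noncomputable section

section Valuation

variable (K : Type*) [Field K] [ValuativeRel K] [TopologicalSpace K]
  [IsNonarchimedeanLocalField K]

/-- The additive valuation of the local field `K`, normalized so that it maps `Kˣ` onto `ℤ`.
(The value at `0` is the junk value `0`.) -/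
def ord (x : K) : ℤ :=
  -WithZero.log (IsNonarchimedeanLocalField.valueGroupWithZeroIsoInt K (ValuativeRel.valuation K x))

variable {Ks : Type*} [Field Ks] [Algebra K Ks]

/-- The unique extension `ν_K` of the normalized valuation of `K` to an algebraic extension `Ks`
of `K`: if `x ≠ 0` has degree `d` over `K`, then `ν_K(x) = ν_K(N(x)) / d`, where
`N(x)` is the norm of `x` from `K(x)` to `K`, which is up to sign the constant coefficient of the
minimal polynomial of `x`. (The value at `0` is the junk value `0`.) -/
def nu (x : Ks) : ℚ :=
  (ord K ((minpoly K x).coeff 0) : ℚ) / ((minpoly K x).natDegree : ℚ)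

variable {K}

/-- `L / K` is totally ramified: its ramification index is its degree `n`,
that is, `ν_K(Lˣ) = (1 / n) ℤ`. -/
def IsTotallyRamified (L : IntermediateField K Ks) : Prop :=
  {r : ℚ | ∃ x ∈ L, x ≠ 0 ∧ nu K x = r} =
    {r : ℚ | ∃ z : ℤ, r = (z : ℚ) / (Module.finrank K L : ℚ)}

/-- For a totally ramified extension `L / K`, the valuation `ν_L` of `Ks`, normalized so that
`ν_L(Lˣ) = ℤ`. -/
def nuOf (L : IntermediateField K Ks) (x : Ks) : ℚ :=
  (Module.finrank K L : ℚ) * nu K x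

/-- `b` is a (lower) ramification break of the totally ramified extension `L / K`:
it is the ramification number `ν_L(σ(π) - π) - 1` of some `K`-embedding `σ` of `L` into `Ks`
other than the inclusion, where `π` is a prime element of `L`. -/
def IsRamificationBreak (L : IntermediateField K Ks) (b : ℚ) : Prop :=
  ∃ σ : L →ₐ[K] Ks, σ ≠ L.val ∧
    ∃ π : L, nuOf L (π : Ks) = 1 ∧ nuOf L (σ π - (π : Ks)) - 1 = b

/-- An automorphism `φ` of `K` induces the identity on the residue field of `K`. -/
def IsResiduallyTrivial (φ : K ≃+* K) : Prop :=
  ∀ x : 𝒪[K], ∃ h : φ (x : K) ∈ 𝒪[K],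
    IsLocalRing.residue 𝒪[K] ⟨φ (x : K), h⟩ = IsLocalRing.residue 𝒪[K] x

theorem isResiduallyTrivial_iff (φ : K ≃+* K) :
    IsResiduallyTrivial φ ↔
      ∀ x : K, ValuativeRel.valuation K x ≤ 1 → ValuativeRel.valuation K (φ x - x) < 1 := by
  have key : ∀ (x y : 𝒪[K]), IsLocalRing.residue 𝒪[K] y = IsLocalRing.residue 𝒪[K] x ↔
      ValuativeRel.valuation K ((y : K) - x) < 1 := by
    intro x y
    rw [← sub_eq_zero, ← map_sub, IsLocalRing.residue_eq_zero_iff, IsLocalRing.mem_maximalIdeal,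
      mem_nonunits_iff,
      Valuation.Integers.isUnit_iff_valuation_eq_one (Valuation.integer.integers _)]
    have h := (y - x).2
    rw [Valuation.mem_integer_iff] at h
    exact (lt_iff_le_and_ne.trans (and_iff_right h)).symm
  constructor
  · intro H x hx
    obtain ⟨h, e⟩ := H ⟨x, hx⟩
    exact (key _ _).1 e
  · intro H x
    have hx := H x x.2
    have h : φ (x : K) ∈ 𝒪[K] := by
      have := 𝒪[K].add_mem (x := φ (x : K) - x) (y := x) hx.le x.2
      simpa using this
    exact ⟨h, (key _ _).2 hx⟩

theorem IsResiduallyTrivial.symm {φ : K ≃+* K} (hφ : IsResiduallyTrivial φ) :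
    IsResiduallyTrivial φ.symm := by
  rw [isResiduallyTrivial_iff] at hφ ⊢
  have hint : ∀ x : K, ValuativeRel.valuation K x ≤ 1 →
      ValuativeRel.valuation K (φ.symm x) ≤ 1 := by
    intro x hx
    by_contra hc
    push Not at hc
    have hx0 : φ.symm x ≠ 0 := by
      intro h0
      simp [h0] at hc
    have h1 : ValuativeRel.valuation K (φ.symm x)⁻¹ < 1 := by
      rw [map_inv₀]; exact inv_lt_one_of_one_lt₀ hc
    have h2 := hφ _ h1.le
    have h3 : ValuativeRel.valuation K (φ (φ.symm x)⁻¹) < 1 := by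
      have := Valuation.map_add_lt _ h2 h1
      simpa using this
    rw [map_inv₀ φ, φ.apply_symm_apply, map_inv₀] at h3
    have hx1 : x ≠ 0 := by
      intro h0
      simp [h0] at hx0
    have : ValuativeRel.valuation K x ≠ 0 := by simpa using hx1
    exact absurd hx (not_le.2 ((inv_lt_one₀ (zero_lt_iff.2 this)).1 h3))
  intro x hx
  have := hφ _ (hint x hx)
  rw [φ.apply_symm_apply] at this
  rwa [Valuation.map_sub_swap]

/-- The extensions `L₁ / K` and `L₂ / K` are `k`-isomorphic, where `k` is the residue field of `K`:
there is a field isomorphism `σ : L₁ → L₂` with `σ(K) = K` such that the automorphism `φ` of `K`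
which is induced by `σ` is the identity on `k`. -/
def KIsomorphic (L₁ L₂ : IntermediateField K Ks) : Prop :=
  ∃ (σ : L₁ ≃+* L₂) (φ : K ≃+* K),
    (∀ x : K, σ (algebraMap K L₁ x) = algebraMap K L₂ (φ x)) ∧ IsResiduallyTrivial φ

variable (K Ks)

/-- `k`-isomorphism is an equivalence relation on the subextensions of `Ks / K`. -/
def kIsoSetoid : Setoid (IntermediateField K Ks) where
  r := KIsomorphic
  iseqv :=
    { refl := fun L => ⟨RingEquiv.refl _, RingEquiv.refl _, fun _ => rfl, fun x => ⟨x.2, rfl⟩⟩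
      symm := by
        rintro L₁ L₂ ⟨σ, φ, h, hφ⟩
        refine ⟨σ.symm, φ.symm, fun x => ?_, hφ.symm⟩
        rw [RingEquiv.symm_apply_eq, h, φ.apply_symm_apply]
      trans := by
        rintro L₁ L₂ L₃ ⟨σ, φ, h, hφ⟩ ⟨τ, ψ, h', hψ⟩
        refine ⟨σ.trans τ, φ.trans ψ, fun x => ?_, fun x => ?_⟩
        · simp [h, h']
        · obtain ⟨m, e⟩ := hφ x
          obtain ⟨m', e'⟩ := hψ ⟨φ x, m⟩
          exact ⟨m', e'.trans e⟩ }

/-- The set of all totally ramified subextensions `L / K` of `Ks / K` of degree `p` with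
ramification break `b`. -/
def extensions (p : ℕ) (b : ℚ) : Set (IntermediateField K Ks) :=
  {L | Module.finrank K L = p ∧ IsTotallyRamified L ∧ IsRamificationBreak L b}

/-- The set `S_b` of `k`-isomorphism classes of totally ramified extensions of `K` of degree `p`
with ramification break `b`. -/
def classes (p : ℕ) (b : ℚ) : Set (Quotient (kIsoSetoid K Ks)) :=
  Quotient.mk (kIsoSetoid K Ks) '' extensions K Ks p b

/-- The set of `k`-isomorphism classes of Galois extensions with break `b`. -/
def galoisClasses (p : ℕ) (b : ℚ) : Set (Quotient (kIsoSetoid K Ks)) :=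
  Quotient.mk (kIsoSetoid K Ks) '' {L ∈ extensions K Ks p b | IsGalois K L}

/-- The set of `k`-isomorphism classes of non-Galois extensions with break `b`. -/
def nonGaloisClasses (p : ℕ) (b : ℚ) : Set (Quotient (kIsoSetoid K Ks)) :=
  Quotient.mk (kIsoSetoid K Ks) '' {L ∈ extensions K Ks p b | ¬ IsGalois K L}

end Valuation

end

end LocalFieldExt

/-! Everything rests on a normal form. Write `n = (p - 1) b`. An extension `L / K` of degree `p`
with break `b` is generated by a root `z` of `X ^ p = Δ * (X + 1)` with `Δ` in `K` of order `n`
(`exists_generator`, `exists_parameter`), and conversely every such `Δ` gives an extension with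
break `b` (`adjoin_mem_extensions`). The conjugates of `z` are `z + s` with `s = 0` or `s ^ (p - 1)
= Δ`, so `L / K` is Galois exactly when `Δ` is a `(p - 1)`-th power in `K` (`isGalois_adjoin_iff`).
Two parameters of the same `L` have a quotient that is a one-unit (`parameter_sub_lt`), so `L`
determines the leading coefficient `D` of `Δ = D * t ^ n * (one-unit)`, where `t` is a uniformizer.

On the side of `K`, Teichmüller representatives form a coefficient field, hence `K` is a Laurent
series field over it, and an automorphism trivial on `k` can send `t` to any other uniformizer
(`exists_automorphism`). Since `p` does not divide `n`, a one-unit is an `n`-th power, so a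
substitution `t ↦ w * t` with `w` a one-unit removes the one-unit factor of `Δ`. The substitution `t
↦ c * t` changes `D` into `D * c ^ n`, and nothing else can happen to `D`. The classes therefore
correspond to `kˣ` modulo `n`-th powers, a quotient of a cyclic group of order `q - 1`, which gives
the first count. If `n = (p - 1) c`, the Galois classes are those where `D` is a `(p - 1)`-th power;
the other two counts follow in the cyclic group.

The normal form is proved for a real-valued valuation `v`. Total ramification enters as the
condition that `v π ^ i` is a value of `K` only if `p` divides `i`, and the break as the factor `δ`
by which an embedding `σ` moves `π`. -/

namespace LocalFieldExt

open scoped NNReal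

/-! ### Expansions in powers of a ramified element. -/

section ValuedExtension

variable {K Ks : Type*} [Field K] [Field Ks] [Algebra K Ks]

/-- The set of values of `K` under a valuation of an extension field. -/
def valueSet (K : Type*) {Ks : Type*} [Field K] [Field Ks] [Algebra K Ks]
    (v : Valuation Ks ℝ≥0) : Set ℝ≥0 :=
  Set.range fun a : K => v (algebraMap K Ks a)

theorem div_mem_valueSet {v : Valuation Ks ℝ≥0} {r s : ℝ≥0} (hr : r ∈ valueSet K v)
    (hs : s ∈ valueSet K v) : r / s ∈ valueSet K v := by
  obtain ⟨a, rfl⟩ := hr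
  obtain ⟨c, rfl⟩ := hs
  exact ⟨a / c, by simp⟩

theorem pow_mem_valueSet {v : Valuation Ks ℝ≥0} {r : ℝ≥0} (hr : r ∈ valueSet K v) (k : ℕ) :
    r ^ k ∈ valueSet K v := by
  obtain ⟨a, rfl⟩ := hr
  exact ⟨a ^ k, by simp⟩

theorem zero_mem_valueSet (v : Valuation Ks ℝ≥0) : (0 : ℝ≥0) ∈ valueSet K v := ⟨0, by simp⟩

/-- Elements of `K` times distinct small powers of `π` have distinct values. -/
theorem exists_dominant_term {p : ℕ} (v : Valuation Ks ℝ≥0) {π : Ks}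
    (hπ : ∀ i : ℕ, ¬ p ∣ i → v π ^ i ∉ valueSet K v) (c : Fin p → K) (hc : c ≠ 0) :
    ∃ j, c j ≠ 0 ∧ (∀ i, i ≠ j →
      v (algebraMap K Ks (c i) * π ^ (i : ℕ)) < v (algebraMap K Ks (c j) * π ^ (j : ℕ))) ∧
      v (∑ i, algebraMap K Ks (c i) * π ^ (i : ℕ)) = v (algebraMap K Ks (c j) * π ^ (j : ℕ)) := by
  obtain ⟨i₀, hi₀⟩ := Function.ne_iff.1 hc
  have hne : ∀ i j : Fin p, (i : ℕ) < j → c i ≠ 0 → c j ≠ 0 →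
      v (algebraMap K Ks (c i) * π ^ (i : ℕ)) ≠ v (algebraMap K Ks (c j) * π ^ (j : ℕ)) := by
    intro i j hij hci hcj h
    have hp : ¬ p ∣ (j : ℕ) - i := fun hd => by
      have := Nat.le_of_dvd (by omega) hd
      omega
    have hπ0 : v π ≠ 0 := fun h0 => hπ _ hp (by
      rw [h0, zero_pow (by omega)]
      exact zero_mem_valueSet v)
    have h1 : v (algebraMap K Ks (c j)) ≠ 0 := by simpa using hcj
    refine hπ _ hp ⟨c i / c j, ?_⟩
    have h2 : v π ^ (j : ℕ) = v π ^ ((j : ℕ) - i) * v π ^ (i : ℕ) := by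
      rw [← pow_add]; congr 1; omega
    simp only [map_mul, map_pow, h2] at h
    have h3 := mul_right_cancel₀ (pow_ne_zero i hπ0) (h.trans (mul_assoc _ _ _).symm)
    simp only [map_div₀, h3]
    field_simp
  obtain ⟨j, -, hj⟩ := Finset.exists_max_image Finset.univ
    (fun i : Fin p => v (algebraMap K Ks (c i) * π ^ (i : ℕ))) ⟨i₀, Finset.mem_univ _⟩
  have hpos : ∀ i, c i ≠ 0 → 0 < v (algebraMap K Ks (c i) * π ^ (i : ℕ)) := by
    intro i hi
    have hπ0 : i ≠ (0 : ℕ) → v π ≠ 0 := fun hi0 h0 => hπ i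
      (fun hd => by have := Nat.le_of_dvd (by omega) hd; omega) (by
        rw [h0, zero_pow hi0]
        exact zero_mem_valueSet v)
    rw [zero_lt_iff, map_mul, map_pow]
    refine mul_ne_zero (by simpa using hi) ?_
    by_cases h : (i : ℕ) = 0
    · simp [h]
    · exact pow_ne_zero _ (hπ0 h)
  have hcj : c j ≠ 0 := by
    intro h
    have := (hpos i₀ hi₀).trans_le (hj i₀ (Finset.mem_univ _))
    simp [h] at this
  have hlt : ∀ i, i ≠ j →
      v (algebraMap K Ks (c i) * π ^ (i : ℕ)) < v (algebraMap K Ks (c j) * π ^ (j : ℕ)) := by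
    intro i hij
    by_cases hci : c i = 0
    · simpa [hci] using hpos j hcj
    refine lt_of_le_of_ne (hj i (Finset.mem_univ _)) ?_
    rcases lt_or_gt_of_ne (fun h => hij (Fin.ext h) : (i : ℕ) ≠ j) with h | h
    · exact hne i j h hci hcj
    · exact (hne j i h hcj hci).symm
  refine ⟨j, hcj, hlt, ?_⟩
  exact Valuation.map_sum_eq_of_lt v (Finset.mem_univ j) fun i hi => hlt i (by simpa using hi)

variable {p : ℕ} [Fact p.Prime] (v : Valuation Ks ℝ≥0) {L : IntermediateField K Ks}
  (hL : Module.finrank K L = p) {π : L}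
  (hπ : ∀ i : ℕ, ¬ p ∣ i → v (π : Ks) ^ i ∉ valueSet K v)

include hL hπ in
-- A linear relation between the first `p` powers of `π` would have a term of strictly largest
-- value, so they are independent and by dimension a basis.
theorem exists_expansion (x : L) :
    ∃ c : Fin p → K, x = ∑ i, algebraMap K L (c i) * π ^ (i : ℕ) := by
  have hp : p.Prime := Fact.out
  have hlin : LinearIndependent K (fun i : Fin p => π ^ (i : ℕ)) := by
    rw [Fintype.linearIndependent_iff]
    intro g hg i
    by_contra hne
    obtain ⟨j, hj, -, h2⟩ := exists_dominant_term v hπ g (fun h => hne (by simp [h]))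
    have h3 : (∑ i, algebraMap K Ks (g i) * (π : Ks) ^ (i : ℕ)) = 0 := by
      have := congrArg (algebraMap L Ks) hg
      simpa [Algebra.smul_def] using this
    rw [h3, map_zero, map_mul, map_pow] at h2
    have hπ0 : v (π : Ks) ≠ 0 := fun h0 => hπ 1 hp.not_dvd_one (by
      rw [h0, pow_one]; exact zero_mem_valueSet v)
    exact mul_ne_zero (by simpa using hj) (pow_ne_zero _ hπ0) h2.symm
  have : Module.Finite K L := Module.finite_of_finrank_pos (hL ▸ hp.pos)
  have : Nonempty (Fin p) := ⟨⟨0, hp.pos⟩⟩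
  let B := basisOfLinearIndependentOfCardEqFinrank hlin (by simp [hL])
  refine ⟨fun i => B.repr x i, ?_⟩
  conv_lhs => rw [← B.sum_repr x]
  simp [B, Algebra.smul_def]

include hL hπ in
theorem exists_approx {x : L} (hx : x ≠ 0) :
    ∃ (c : K) (i : ℕ), i < p ∧ v ((x : Ks) - algebraMap K Ks c * (π : Ks) ^ i) < v (x : Ks) ∧
      v (x : Ks) = v (algebraMap K Ks c * (π : Ks) ^ i) := by
  obtain ⟨c, hc⟩ := exists_expansion v hL hπ x
  have hc0 : c ≠ 0 := by
    rintro rfl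
    simp [hc] at hx
  obtain ⟨j, hj, h1, h2⟩ := exists_dominant_term v hπ c hc0
  have hxe : (x : Ks) = ∑ i, algebraMap K Ks (c i) * (π : Ks) ^ (i : ℕ) := by
    conv_lhs => rw [hc]
    simp
  refine ⟨c j, j, j.2, ?_, by rw [hxe, h2]⟩
  rw [hxe, h2, ← Finset.sum_erase_add _ _ (Finset.mem_univ j), add_sub_cancel_right]
  refine Valuation.map_sum_lt' v ?_ fun i hi => h1 i (Finset.ne_of_mem_erase hi)
  have hπ0 : v (π : Ks) ≠ 0 := fun h0 => hπ 1 (Fact.out : p.Prime).not_dvd_one (by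
      rw [h0, pow_one]; exact zero_mem_valueSet v)
  rw [zero_lt_iff, map_mul, map_pow]
  exact mul_ne_zero (by simpa using hj) (pow_ne_zero _ hπ0)

include hL hπ in
-- The dominant term of the expansion must be the constant one: an exponent `0 < i < p` would make
-- `v π ^ i` a value of `K`.
theorem exists_approx_base {x : L} (hx : x ≠ 0) (hv : v (x : Ks) ∈ valueSet K v) :
    ∃ c : K, v ((x : Ks) - algebraMap K Ks c) < v (x : Ks) ∧
      v (x : Ks) = v (algebraMap K Ks c) := by
  obtain ⟨c, i, hi, h1, h2⟩ := exists_approx v hL hπ hx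
  by_cases h0 : i = 0
  · subst h0
    exact ⟨c, by simpa using h1, by simpa using h2⟩
  · exfalso
    refine hπ i (fun hd => by have := Nat.le_of_dvd (by omega) hd; omega) ?_
    have hc : v (algebraMap K Ks c) ≠ 0 := by
      intro h
      rw [map_mul, h, zero_mul] at h2
      simp [h2] at h1
    have : v (π : Ks) ^ i = v (x : Ks) / v (algebraMap K Ks c) := by
      rw [h2, map_mul, map_pow]; field_simp
    rw [this]
    exact div_mem_valueSet hv ⟨c, rfl⟩

include hL hπ in
-- Removing the constant term of the expansion leaves a dominant term with exponent between `1` and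
-- `p - 1`. This adjusts an element modulo `K`, without affecting `σ y - y`, so that
-- `map_conj_sub_eq` applies.
theorem exists_sub_notMem_valueSet {y : L} (hy : ∀ a : K, y ≠ algebraMap K L a) :
    ∃ a : K, v ((y : Ks) - algebraMap K Ks a) ∉ valueSet K v := by
  have hp : p.Prime := Fact.out
  obtain ⟨c, hc⟩ := exists_expansion v hL hπ y
  have hye : (y : Ks) = ∑ i, algebraMap K Ks (c i) * (π : Ks) ^ (i : ℕ) := by
    conv_lhs => rw [hc]
    simp
  let o : Fin p := ⟨0, hp.pos⟩
  let c' := Function.update c o 0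
  have hsum : (y : Ks) - algebraMap K Ks (c o) =
      ∑ i, algebraMap K Ks (c' i) * (π : Ks) ^ (i : ℕ) := by
    rw [hye, ← Finset.sum_erase_add _ _ (Finset.mem_univ o),
      ← Finset.sum_erase_add (a := o) (f := fun i => algebraMap K Ks (c' i) * (π : Ks) ^ (i : ℕ))
        _ (Finset.mem_univ o)]
    have : ∀ i ∈ Finset.univ.erase o, algebraMap K Ks (c i) * (π : Ks) ^ (i : ℕ) =
        algebraMap K Ks (c' i) * (π : Ks) ^ (i : ℕ) := by
      intro i hi
      simp [c', Function.update_of_ne (Finset.ne_of_mem_erase hi)]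
    rw [Finset.sum_congr rfl this]
    simp [c', o]
  have hc' : c' ≠ 0 := by
    intro h
    refine hy (c o) (Subtype.ext ?_)
    rw [h] at hsum
    simpa [sub_eq_zero] using hsum
  obtain ⟨j, hj, -, h2⟩ := exists_dominant_term v hπ c' hc'
  have hjo : j ≠ o := by
    rintro rfl
    simp [c'] at hj
  have hj0 : (j : ℕ) ≠ 0 := fun h => hjo (Fin.ext h)
  refine ⟨c o, fun hmem => hπ j
    (fun hd => by have := Nat.le_of_dvd (by omega) hd; omega) ?_⟩
  rw [hsum, h2, map_mul, map_pow] at hmem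
  have hcj : v (algebraMap K Ks (c' j)) ≠ 0 := by simpa using hj
  have := div_mem_valueSet hmem (⟨c' j, rfl⟩ : _ ∈ valueSet K v)
  rwa [mul_div_cancel_left₀ _ hcj] at this

/-! ### The effect of an embedding on values. -/

section Conjugation

variable [CharP K p] {σ : L →ₐ[K] Ks} {δ : ℝ≥0} (hδ : δ < 1)
  (hσ : v (σ π - (π : Ks)) = δ * v (π : Ks))

/-- The cofactor of `η` is a geometric sum congruent to `i`, and `i` is a nonzero element of the
prime field, hence a root of unity of value `1`. -/
theorem map_one_add_pow_sub_one [CharP Ks p] {η : Ks} (hη : v η < 1) {i : ℕ} (hi : ¬ p ∣ i) :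
    v ((1 + η) ^ i - 1) = v η := by
  have hgeom : (1 + η) ^ i - 1 = (∑ k ∈ Finset.range i, (1 + η) ^ k) * η := by
    rw [← geom_sum_mul]; ring
  rw [hgeom, map_mul]
  have hv1 : ∀ k : ℕ, v ((1 + η) ^ k - 1) < 1 := by
    intro k
    have : (1 + η) ^ k - 1 = (∑ k ∈ Finset.range k, (1 + η) ^ k) * η := by
      rw [← geom_sum_mul]; ring
    rw [this, map_mul]
    have h1 : v (∑ k ∈ Finset.range k, (1 + η) ^ k) ≤ 1 :=
      Valuation.map_sum_le v fun j _ => by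
        rw [map_pow, Valuation.map_one_add_of_lt v hη, one_pow]
    calc _ ≤ 1 * v η := by gcongr
      _ < 1 := by rwa [one_mul]
  have hi1 : v (i : Ks) = 1 := by
    have hne : (i : ZMod p) ≠ 0 := by rwa [Ne, ZMod.natCast_eq_zero_iff]
    have h := congrArg (fun z => v (ZMod.castHom (dvd_refl p) Ks z)) (ZMod.pow_card_sub_one_eq_one hne)
    simp only [map_pow, map_natCast, map_one] at h
    exact (pow_eq_one_iff_of_nonneg zero_le
      (Nat.sub_ne_zero_of_lt (Fact.out : p.Prime).one_lt)).1 h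
  have : v (∑ k ∈ Finset.range i, (1 + η) ^ k) = 1 := by
    have e : (∑ k ∈ Finset.range i, (1 + η) ^ k) =
        (∑ k ∈ Finset.range i, ((1 + η) ^ k - 1)) + i := by
      simp [Finset.sum_sub_distrib]
    rw [e, Valuation.map_add_eq_of_lt_right, hi1]
    rw [hi1]
    exact Valuation.map_sum_lt' v one_pos fun k _ => hv1 k
  rw [this, one_mul]

include hπ hδ hσ in
theorem map_conj_pow_sub_pow {i : ℕ} (hi : ¬ p ∣ i) :
    v (σ π ^ i - (π : Ks) ^ i) = δ * v (π : Ks) ^ i := by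
  have : CharP Ks p := charP_of_injective_algebraMap (algebraMap K Ks).injective p
  have hπ0 : v (π : Ks) ≠ 0 := fun h0 => hπ 1 (Fact.out : p.Prime).not_dvd_one (by
      rw [h0, pow_one]; exact zero_mem_valueSet v)
  have hπ1 : (π : Ks) ≠ 0 := by simpa using hπ0
  have hη : v (σ π / π - 1) = δ := by
    rw [div_sub_one hπ1, map_div₀, hσ]; field_simp
  have : σ π ^ i - (π : Ks) ^ i = ((1 + (σ π / π - 1)) ^ i - 1) * (π : Ks) ^ i := by
    rw [add_sub_cancel, div_pow]; field_simp
  rw [this, map_mul, map_pow, map_one_add_pow_sub_one (p := p) v (hη ▸ hδ) hi, hη]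

include hL hπ hδ hσ in
-- The constant term of the expansion is fixed, and each other term moves by exactly `δ` times its
-- value.
theorem map_conj_sub_le (x : L) : v (σ x - (x : Ks)) ≤ δ * v (x : Ks) := by
  obtain ⟨c, hc⟩ := exists_expansion v hL hπ x
  by_cases hc0 : c = 0
  · simp [hc, hc0]
  obtain ⟨j, hj, h1, h2⟩ := exists_dominant_term v hπ c hc0
  have hxe : (x : Ks) = ∑ i, algebraMap K Ks (c i) * (π : Ks) ^ (i : ℕ) := by
    conv_lhs => rw [hc]
    simp
  have hσx : σ x - (x : Ks) =
      ∑ i, algebraMap K Ks (c i) * (σ π ^ (i : ℕ) - (π : Ks) ^ (i : ℕ)) := by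
    rw [hxe]
    conv_lhs => rw [hc]
    simp [mul_sub, Finset.sum_sub_distrib]
  rw [hσx, hxe, h2]
  refine Valuation.map_sum_le v fun i _ => ?_
  by_cases hi : p ∣ (i : ℕ)
  · have : (i : ℕ) = 0 := Nat.eq_zero_of_dvd_of_lt hi i.2
    simp [this]
  rw [map_mul, map_conj_pow_sub_pow v hπ hδ hσ hi, mul_left_comm]
  gcongr
  rw [← map_pow, ← map_mul]
  by_cases hij : i = j
  · rw [hij]
  · exact (h1 i hij).le

include hL hπ hδ hσ in
-- Here the dominant term is not the constant one, so it moves by exactly `δ` times its value; the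
-- smaller remainder moves by less.
theorem map_conj_sub_eq {x : L} (hx : v (x : Ks) ∉ valueSet K v) :
    v (σ x - (x : Ks)) = δ * v (x : Ks) := by
  have hx0 : x ≠ 0 := by
    rintro rfl
    exact hx (by simpa using zero_mem_valueSet v)
  obtain ⟨c, i, hi, h1, h2⟩ := exists_approx v hL hπ hx0
  have hpi : ¬ p ∣ i := by
    intro hd
    obtain rfl : i = 0 := Nat.eq_zero_of_dvd_of_lt hd hi
    exact hx ⟨c, by simpa using h2.symm⟩
  by_cases hδ0 : δ = 0
  · have := map_conj_sub_le v hL hπ hδ hσ x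
    rw [hδ0, zero_mul] at this ⊢
    exact le_zero_iff.1 this
  have e : σ x - (x : Ks) = (σ (x - algebraMap K L c * π ^ i) - ((x - algebraMap K L c * π ^ i : L) : Ks))
      + algebraMap K Ks c * (σ π ^ i - (π : Ks) ^ i) := by
    have : ((algebraMap K L c : L) : Ks) = algebraMap K Ks c := rfl
    simp [this]
    ring
  have h3 : v (algebraMap K Ks c * (σ π ^ i - (π : Ks) ^ i)) = δ * v (x : Ks) := by
    rw [map_mul, map_conj_pow_sub_pow v hπ hδ hσ hpi, h2, map_mul, map_pow]; ring
  rw [e, Valuation.map_add_eq_of_lt_right, h3]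
  rw [h3]
  refine (map_conj_sub_le v hL hπ hδ hσ _).trans_lt ?_
  have : v ((x - algebraMap K L c * π ^ i : L) : Ks) < v (x : Ks) := by
    simpa using h1
  gcongr

end Conjugation

end ValuedExtension

end LocalFieldExt

namespace LocalFieldExt

/-! ### One-units of a valuation. -/

section OneUnits

variable {Ks Γ₀ : Type*} [Field Ks] [LinearOrderedCommGroupWithZero Γ₀] (v : Valuation Ks Γ₀)

theorem one_unit_mul {x y : Ks} (hx : v (x - 1) < 1) (hy : v (y - 1) < 1) :
    v (x * y - 1) < 1 := by
  have e : x * y - 1 = (x - 1) * (y - 1) + ((x - 1) + (y - 1)) := by ring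
  rw [e]
  refine Valuation.map_add_lt v ?_ (Valuation.map_add_lt v hx hy)
  rw [map_mul]
  exact mul_lt_one_of_lt_of_le hx hy.le

theorem one_unit_pow {x : Ks} (hx : v (x - 1) < 1) (k : ℕ) : v (x ^ k - 1) < 1 := by
  induction k with
  | zero => simp
  | succ k ih => rw [pow_succ]; exact one_unit_mul v ih hx

theorem one_unit_value {x : Ks} (hx : v (x - 1) < 1) : v x = 1 := by
  have := Valuation.map_one_add_of_lt v hx
  rwa [add_sub_cancel] at this

theorem one_unit_inv {x : Ks} (hx : v (x - 1) < 1) : v (x⁻¹ - 1) < 1 := by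
  have h1 := one_unit_value v hx
  have hx0 : x ≠ 0 := by
    rintro rfl
    simp at h1
  have e : x⁻¹ - 1 = -((x - 1) / x) := by field_simp; ring
  rw [e, Valuation.map_neg, map_div₀, h1, div_one]
  exact hx

theorem one_unit_div {x y : Ks} (hx : v (x - 1) < 1) (hy : v (y - 1) < 1) :
    v (x / y - 1) < 1 := by
  rw [div_eq_mul_inv]
  exact one_unit_mul v hx (one_unit_inv v hy)

end OneUnits

open scoped NNReal

/-! ### The normal form `z ^ p = Δ * (z + 1)` and the comparison of its parameters. -/

section Generator

variable {K Ks : Type*} [Field K] [Field Ks] [Algebra K Ks]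
  {p : ℕ} [Fact p.Prime] (v : Valuation Ks ℝ≥0)

theorem prod_sub_zmod_mul [CharP Ks p] (x y : Ks) :
    ∏ a : ZMod p, (x - ZMod.castHom (dvd_refl p) Ks a * y) = x ^ p - y ^ (p - 1) * x := by
  have hp : p.Prime := Fact.out
  have h1 : ∏ a : ZMod p, (Polynomial.X - Polynomial.C a) = Polynomial.X ^ p - Polynomial.X := by
    have hcard : Polynomial.natDegree (Polynomial.X ^ p - Polynomial.X : Polynomial (ZMod p)) = p :=
      FiniteField.X_pow_card_sub_X_natDegree_eq _ hp.one_lt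
    have hroots := FiniteField.roots_X_pow_card_sub_X (ZMod p)
    rw [ZMod.card] at hroots
    have hmonic : (Polynomial.X ^ p - Polynomial.X : Polynomial (ZMod p)).Monic :=
      Polynomial.monic_X_pow_sub (by
        rw [Polynomial.degree_X]
        exact_mod_cast hp.one_lt)
    have := Polynomial.prod_multiset_X_sub_C_of_monic_of_roots_card_eq hmonic (by
      rw [hcard, hroots]; simp [ZMod.card])
    rw [hroots] at this
    simpa using this
  by_cases hy : y = 0
  · subst hy
    simp [zero_pow (Nat.sub_ne_zero_of_lt hp.one_lt), ZMod.card]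
  have h2 := congrArg (Polynomial.eval₂ (ZMod.castHom (dvd_refl p) Ks) (x / y)) h1
  rw [Polynomial.eval₂_finsetProd] at h2
  simp only [Polynomial.eval₂_sub, Polynomial.eval₂_X, Polynomial.eval₂_C,
    Polynomial.eval₂_X_pow] at h2
  have h3 : ∏ a : ZMod p, (x - ZMod.castHom (dvd_refl p) Ks a * y) =
      (∏ a : ZMod p, (x / y - ZMod.castHom (dvd_refl p) Ks a)) * y ^ p := by
    have hyp : y ^ p = ∏ _a : ZMod p, y := by simp [ZMod.card]
    rw [hyp, ← Finset.prod_mul_distrib]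
    refine Finset.prod_congr rfl fun a _ => ?_
    field_simp
  rw [h3, h2, sub_mul, div_pow, div_mul_cancel₀ _ (pow_ne_zero _ hy)]
  congr 1
  obtain ⟨k, rfl⟩ : ∃ k, p = k + 1 := ⟨p - 1, (Nat.succ_pred hp.ne_zero).symm⟩
  rw [Nat.add_sub_cancel, pow_succ]
  field_simp

/-- A near-root of `X ^ (p - 1) = y ^ (p - 1)` is close to a root. -/
theorem exists_close_root [CharP Ks p] {x y : Ks} (hxy : v x = v y)
    (h : v (x ^ (p - 1) - y ^ (p - 1)) < v (y ^ (p - 1))) :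
    ∃ s : Ks, s ^ (p - 1) = y ^ (p - 1) ∧ v (x - s) < v s ∧ v s = v y := by
  have hp : p.Prime := Fact.out
  have hy : v y ≠ 0 := by
    intro h0
    rw [map_pow, h0, zero_pow (Nat.sub_ne_zero_of_lt hp.one_lt)] at h
    exact not_lt_zero h
  -- If no nonzero prime field multiple of `y` is close to `x`, all `p` factors of `x ^ p - y ^ (p -
  -- 1) * x` have value at least `v y`, which makes their product too large.
  by_contra! hcon
  have hone : ∀ a : ZMod p, a ≠ 0 → (ZMod.castHom (dvd_refl p) Ks a) ^ (p - 1) = 1 := by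
    intro a ha
    rw [← map_pow, ZMod.pow_card_sub_one_eq_one ha, map_one]
  have hvone : ∀ a : ZMod p, a ≠ 0 → v (ZMod.castHom (dvd_refl p) Ks a) = 1 := by
    intro a ha
    have h := congrArg v (hone a ha)
    rw [map_pow, map_one] at h
    exact (pow_eq_one_iff_of_nonneg zero_le (Nat.sub_ne_zero_of_lt hp.one_lt)).1 h
  have hge : ∀ a : ZMod p, v y ≤ v (x - ZMod.castHom (dvd_refl p) Ks a * y) := by
    intro a
    by_cases ha : a = 0
    · simp [ha, hxy]
    · by_contra! hlt
      have hs : v (ZMod.castHom (dvd_refl p) Ks a * y) = v y := by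
        rw [map_mul, hvone a ha, one_mul]
      refine hcon (ZMod.castHom (dvd_refl p) Ks a * y) ?_ ?_ hs
      · rw [mul_pow, hone a ha, one_mul]
      · rwa [hs]
  have hprod : v y ^ p ≤ v (x ^ p - y ^ (p - 1) * x) := by
    rw [← prod_sub_zmod_mul, map_prod]
    calc v y ^ p = ∏ _a : ZMod p, v y := by simp [ZMod.card]
      _ ≤ _ := Finset.prod_le_prod' fun a _ => hge a
  have e : x ^ p - y ^ (p - 1) * x = (x ^ (p - 1) - y ^ (p - 1)) * x := by
    rw [sub_mul, ← pow_succ, Nat.sub_add_cancel hp.one_le]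
  have e2 : v y ^ p = v (y ^ (p - 1)) * v y := by
    rw [map_pow, ← pow_succ, Nat.sub_add_cancel hp.one_le]
  rw [e, e2, map_mul, hxy] at hprod
  exact absurd hprod (not_le.2 (by gcongr))

variable {L : IntermediateField K Ks} (hL : Module.finrank K L = p)

include hL in
theorem adjoin_simple_eq_of_finrank_prime {x : L} (hx : ∀ a : K, x ≠ algebraMap K L a) :
    IntermediateField.adjoin K {(x : Ks)} = L := by
  have hp : p.Prime := Fact.out
  have : Module.Finite K L := Module.finite_of_finrank_pos (hL ▸ hp.pos)
  have hle : IntermediateField.adjoin K {(x : Ks)} ≤ L := by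
    rw [IntermediateField.adjoin_simple_le_iff]; exact x.2
  refine IntermediateField.eq_of_le_of_finrank_eq hle ?_
  have hdvd : Module.finrank K (IntermediateField.adjoin K {(x : Ks)}) ∣ p := by
    rw [← hL]; exact IntermediateField.finrank_dvd_of_le_right hle
  rcases (Nat.dvd_prime hp).1 hdvd with h | h
  · exfalso
    rw [IntermediateField.finrank_eq_one_iff] at h
    have : (x : Ks) ∈ (⊥ : IntermediateField K Ks) := h ▸ IntermediateField.mem_adjoin_simple_self K _
    obtain ⟨a, ha⟩ := IntermediateField.mem_bot.1 this
    exact hx a (Subtype.ext ha.symm)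
  · rw [h, hL]

include hL in
-- The degree is prime, so a fixed element outside `K` would generate `L` and force `σ` to be the
-- inclusion.
theorem conj_eq_self_iff {σ : L →ₐ[K] Ks} (hσ : σ ≠ L.val) (x : L) :
    σ x = x ↔ ∃ a : K, x = algebraMap K L a := by
  constructor
  · intro h
    by_contra! hx
    refine hσ ?_
    have hadj := adjoin_simple_eq_of_finrank_prime hL hx
    have hall : ∀ y : Ks, ∀ hy : y ∈ IntermediateField.adjoin K {(x : Ks)},
        σ ⟨y, hadj ▸ hy⟩ = y := by
      intro y hy
      induction hy using IntermediateField.adjoin_induction with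
      | mem y hy =>
        obtain rfl : y = x := hy
        exact h
      | algebraMap a => exact σ.commutes a
      | add y z hy hz h1 h2 =>
        have := map_add σ ⟨y, hadj ▸ hy⟩ ⟨z, hadj ▸ hz⟩
        rw [h1, h2] at this
        exact this
      | inv y hy h1 =>
        have := map_inv₀ σ ⟨y, hadj ▸ hy⟩
        rw [h1] at this
        exact this
      | mul y z hy hz h1 h2 =>
        have := map_mul σ ⟨y, hadj ▸ hy⟩ ⟨z, hadj ▸ hz⟩
        rw [h1, h2] at this
        exact this
    ext y
    exact hall y (hadj.symm ▸ y.2)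
  · rintro ⟨a, rfl⟩
    rw [σ.commutes]
    rfl

variable {π : L} (hπ : ∀ i : ℕ, ¬ p ∣ i → v (π : Ks) ^ i ∉ valueSet K v) [CharP K p]
  {σ : L →ₐ[K] Ks} {δ : ℝ≥0} (hδ : δ < 1)
  (hσ : v (σ π - (π : Ks)) = δ * v (π : Ks))

/-- With `p = k + 1`, this turns an equation `u ^ p = β * u + α` into the normal form for `z = (β /
α) * u`. -/
theorem rescale_additive_identity {F : Type*} [Field F] {α : F} (hα : α ≠ 0) (β x : F) (k : ℕ) :
    (β / α) ^ (k + 1) * (β * x + α) = β ^ (k + 1) / α ^ k * (β / α * x + 1) := by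
  have h : β * x + α = α * (β / α * x + 1) := by field_simp
  rw [h, div_pow, pow_succ α, ← mul_assoc, div_mul_eq_mul_div, mul_div_mul_right _ _ hα]

include hL hπ hδ hσ in
/-- A ramified extension of degree `p` is generated by a root of `X ^ p = Δ * (X + 1)`. -/
theorem exists_generator (hσ1 : σ ≠ L.val) (hδ0 : δ ≠ 0)
    (hroot : ∀ d : K, d ≠ 0 → ∃ s : Ks, s ^ (p - 1) = algebraMap K Ks d)
    (hclosed : ∀ W : Submodule K Ks, FiniteDimensional K W → ∀ s : Ks,
      (∀ ε : ℝ≥0, 0 < ε → ∃ w ∈ W, v (s - w) < ε) → s ∈ W)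
    {n : ℕ} (hn : ¬ p ∣ n) (hπp : v (π : Ks) ^ p ∈ valueSet K v)
    (hδn : δ ^ (p - 1) = v (π : Ks) ^ n) :
    ∃ (Δ : K) (z : L), z ^ p = algebraMap K L Δ * (z + 1) ∧
      v (algebraMap K Ks Δ) = v (π : Ks) ^ (p * n) ∧ v (z : Ks) = v (π : Ks) ^ n := by
  have hp : p.Prime := Fact.out
  have hp1 : p - 1 ≠ 0 := Nat.sub_ne_zero_of_lt hp.one_lt
  have : CharP Ks p := charP_of_injective_algebraMap (algebraMap K Ks).injective p
  have : CharP L p := charP_of_injective_algebraMap (algebraMap K L).injective p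
  have : Module.Finite K L := Module.finite_of_finrank_pos (hL ▸ hp.pos)
  have hle := map_conj_sub_le v hL hπ hδ hσ
  have heq := fun x => map_conj_sub_eq v hL hπ hδ hσ (x := x)
  have hfrob : ∀ x : L, σ (x ^ p) - ((x ^ p : L) : Ks) = (σ x - (x : Ks)) ^ p := by
    intro x
    rw [sub_pow_char, map_pow]; rfl
  have hconst : ∀ a : K, σ (algebraMap K L a) = algebraMap K Ks a := σ.commutes
  have hcoe : ∀ a : K, ((algebraMap K L a : L) : Ks) = algebraMap K Ks a := fun _ => rfl
  -- a first approximation `y₀`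
  set y₀ : L := π ^ n with hy₀
  have hvy₀ : v (y₀ : Ks) = v (π : Ks) ^ n := by simp [hy₀]
  have hy₀S : v (y₀ : Ks) ∉ valueSet K v := hvy₀ ▸ hπ n hn
  set r : ℝ≥0 := v (π : Ks) ^ n with hr
  have hr0 : 0 < r := by rw [← hδn]; exact pow_pos (zero_lt_iff.2 hδ0) _
  have hr1 : r < 1 := by rw [← hδn]; exact pow_lt_one₀ zero_le hδ hp1
  have hrp : r ^ p ∈ valueSet K v := by
    rw [hr, ← pow_mul, mul_comm, pow_mul]; exact pow_mem_valueSet hπp n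
  have hds₀ : v (σ y₀ - (y₀ : Ks)) = δ * r := by rw [heq y₀ hy₀S, hvy₀]
  have hy₀p : ∀ a : K, y₀ ^ p ≠ algebraMap K L a := by
    intro a ha
    have h1 := hfrob y₀
    rw [ha, hconst, hcoe, sub_self] at h1
    have h2 := congrArg v h1
    rw [map_zero, map_pow, hds₀] at h2
    exact (pow_pos (mul_pos (zero_lt_iff.2 hδ0) hr0) p).ne h2
  obtain ⟨a₀, ha₀⟩ := exists_sub_notMem_valueSet v hL hπ hy₀p
  -- Frobenius raises differences `σ x - x` to the `p`-th power. As `δ ^ (p - 1) = r`, the exact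
  -- scaling law gives `v w = r ^ (p + 1)`. So `w / y₀` has the value `r ^ p` of `K` and is
  -- approximated by some `d` in `K`.
  set w : L := y₀ ^ p - algebraMap K L a₀ with hw
  have hw' : v (w : Ks) ∉ valueSet K v := ha₀
  have hdw : σ w - (w : Ks) = (σ y₀ - (y₀ : Ks)) ^ p := by
    rw [← hfrob, hw, map_sub, hconst]
    have : ((y₀ ^ p - algebraMap K L a₀ : L) : Ks) = ((y₀ ^ p : L) : Ks) - algebraMap K Ks a₀ := rfl
    rw [this]; ring
  have hvw : v (w : Ks) = r ^ p * r := by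
    have h1 := heq w hw'
    rw [hdw, map_pow, hds₀, mul_pow] at h1
    have h2 : δ ^ p = δ * r := by
      rw [← hδn, ← pow_succ', Nat.sub_add_cancel hp.one_le]
    rw [h2, mul_assoc] at h1
    rw [← mul_left_cancel₀ hδ0 h1, mul_comm]
  have hy₀0 : (y₀ : Ks) ≠ 0 := by
    intro h; rw [h, map_zero] at hvy₀; exact hr0.ne hvy₀
  have hw0 : (w : Ks) ≠ 0 := by
    intro h; rw [h, map_zero] at hvw; exact (mul_pos (pow_pos hr0 p) hr0).ne hvw
  have hvq : v ((w / y₀ : L) : Ks) = r ^ p := by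
    have : ((w / y₀ : L) : Ks) = (w : Ks) / y₀ := rfl
    rw [this, map_div₀, hvw, hvy₀, mul_div_cancel_right₀ _ hr0.ne']
  obtain ⟨d, hd1, hd2⟩ := exists_approx_base v hL hπ (x := w / y₀)
    (by intro h; rw [h] at hvq; simp at hvq; exact (pow_pos hr0 p).ne hvq) (hvq ▸ hrp)
  rw [hvq] at hd1 hd2
  have hd0 : d ≠ 0 := by
    rintro rfl
    rw [map_zero, map_zero] at hd2
    exact (pow_pos hr0 p).ne' hd2
  have hd0' : algebraMap K Ks d ≠ 0 := by simpa using hd0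
  set s₀ : Ks := σ y₀ - (y₀ : Ks) with hs₀
  have hs₀0 : s₀ ≠ 0 := by
    intro h; rw [h, map_zero] at hds₀; exact (mul_pos (zero_lt_iff.2 hδ0) hr0).ne hds₀
  -- Applying `σ - 1` to `w ≈ d * y₀` gives `s₀ ^ p ≈ d * s₀`.
  have hclose : v (s₀ ^ (p - 1) - algebraMap K Ks d) < v (algebraMap K Ks d) := by
    have h1 : (s₀ ^ (p - 1) - algebraMap K Ks d) * s₀ =
        σ (w - algebraMap K L d * y₀) - ((w - algebraMap K L d * y₀ : L) : Ks) := by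
      rw [sub_mul, ← pow_succ, Nat.sub_add_cancel hp.one_le, ← hdw, map_sub σ w, map_mul, hconst]
      have : ((w - algebraMap K L d * y₀ : L) : Ks) = (w : Ks) - algebraMap K Ks d * y₀ := rfl
      rw [this]; ring
    have h2 : v ((w - algebraMap K L d * y₀ : L) : Ks) < r ^ p * r := by
      have : ((w - algebraMap K L d * y₀ : L) : Ks) =
          (((w / y₀ : L) : Ks) - algebraMap K Ks d) * y₀ := by
        have e : ((w / y₀ : L) : Ks) = (w : Ks) / y₀ := rfl
        rw [e, sub_mul, div_mul_cancel₀ _ hy₀0]; rfl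
      rw [this, map_mul, hvy₀]
      gcongr
    have h3 := (hle (w - algebraMap K L d * y₀)).trans_lt
      (mul_lt_mul_of_pos_left h2 (zero_lt_iff.2 hδ0))
    rw [← h1, map_mul, hds₀, mul_left_comm] at h3
    rw [← hd2]
    exact lt_of_mul_lt_mul_right (lt_of_mul_lt_mul_left h3 zero_le) zero_le
  -- the exact solution `s` near `s₀`
  obtain ⟨s₁, hs₁⟩ := hroot d hd0
  have hvs : v s₀ = v s₁ := by
    have h1 : v s₀ ^ (p - 1) = v s₁ ^ (p - 1) := by
      rw [← map_pow, ← map_pow, hs₁]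
      have := Valuation.map_add_eq_of_lt_left v hclose
      rwa [add_sub_cancel] at this
    exact pow_left_injective hp1 h1
  obtain ⟨s, hs, hs₀s, hvs1⟩ := exists_close_root v hvs (by rwa [hs₁])
  rw [hs₁] at hs
  have hs0 : s ≠ 0 := by
    rintro rfl
    rw [zero_pow hp1] at hs
    exact hd0' hs.symm
  have hsp : s ^ p = algebraMap K Ks d * s := by
    rw [← hs, ← pow_succ, Nat.sub_add_cancel hp.one_le]
  let D : L →ₗ[K] Ks := σ.toLinearMap - L.val.toLinearMap
  have hD : ∀ x, D x = σ x - (x : Ks) := fun _ => rfl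
  -- Since `s ^ p = d * s`, the map `x ↦ d⁻¹ * x ^ p` turns a difference `s * (1 + η)` into `s * (1
  -- + η ^ p)`. The differences of the iterates converge to `s`, and the range of `σ - 1` is
  -- finite-dimensional, hence closed, so it contains `s`.
  let y : ℕ → L := fun k => Nat.rec y₀ (fun _ x => algebraMap K L d⁻¹ * x ^ p) k
  have hy : ∀ k, D (y k) = s * (1 + (s₀ / s - 1)) ^ p ^ k := by
    intro k
    induction k with
    | zero =>
      change s₀ = _
      rw [pow_zero, pow_one, add_sub_cancel, mul_div_cancel₀ _ hs0]
    | succ k ih =>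
      have e : y (k + 1) = algebraMap K L d⁻¹ * y k ^ p := rfl
      have e2 : ((algebraMap K L d⁻¹ * y k ^ p : L) : Ks) =
        algebraMap K Ks d⁻¹ * ((y k ^ p : L) : Ks) := rfl
      rw [e, hD, map_mul, hconst, e2, ← mul_sub, hfrob, ← hD, ih, mul_pow, hsp, map_inv₀,
        ← pow_mul, ← pow_succ]
      field_simp
  have hsW : s ∈ LinearMap.range D := by
    refine hclosed _ inferInstance s fun ε hε => ?_
    have hm : v (s₀ / s - 1) < 1 := by
      rw [div_sub_one hs0, map_div₀]
      exact (div_lt_one₀ (zero_lt_iff.2 (by simpa using hs0))).2 hs₀s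
    obtain ⟨k, hk⟩ := exists_pow_lt_of_lt_one (div_pos hε (zero_lt_iff.2 ((map_ne_zero v).2 hs0))) hm
    refine ⟨D (y k), ⟨_, rfl⟩, ?_⟩
    rw [hy, add_pow_char_pow, one_pow, mul_add, mul_one, sub_add_cancel_left, Valuation.map_neg, map_mul,
      map_pow, mul_comm, ← lt_div_iff₀ (zero_lt_iff.2 ((map_ne_zero v).2 hs0))]
    refine lt_of_le_of_lt ?_ hk
    exact pow_le_pow_of_le_one zero_le hm.le (Nat.lt_pow_self hp.one_lt).le
  obtain ⟨y', hy'⟩ := hsW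
  have hy'K : ∀ a : K, y' ≠ algebraMap K L a := by
    rintro a rfl
    rw [hD, hconst, hcoe, sub_self] at hy'
    exact hs0 hy'.symm
  obtain ⟨a₁, ha₁⟩ := exists_sub_notMem_valueSet v hL hπ hy'K
  set u : L := y' - algebraMap K L a₁ with hu
  have hu' : v (u : Ks) ∉ valueSet K v := ha₁
  have hDu : σ u - (u : Ks) = s := by
    rw [← hD, hu, map_sub, hy', hD, hconst, hcoe, sub_self, sub_zero]
  have hvu : v (u : Ks) = r := by
    have h1 := heq u hu'
    rw [hDu, hvs1, ← hvs, hds₀] at h1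
    exact (mul_left_cancel₀ hδ0 h1).symm
  -- `u ^ p - d * u` is fixed by `σ`, because its difference is `s ^ p - d * s = 0`.
  obtain ⟨a, ha⟩ := (conj_eq_self_iff hL hσ1 (u ^ p - algebraMap K L d * u)).1 (by
    have e : ((u ^ p - algebraMap K L d * u : L) : Ks) =
      ((u ^ p : L) : Ks) - algebraMap K Ks d * u := rfl
    rw [e, ← sub_eq_zero, map_sub, map_mul, hconst]
    have : σ (u ^ p) - algebraMap K Ks d * σ u - (((u ^ p : L) : Ks) - algebraMap K Ks d * u) =
      (σ (u ^ p) - ((u ^ p : L) : Ks)) - algebraMap K Ks d * (σ u - (u : Ks)) := by ring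
    rw [this, hfrob, hDu, hsp, sub_self])
  have hva : v (algebraMap K Ks a) = r ^ p := by
    have e : algebraMap K Ks a = (u : Ks) ^ p - algebraMap K Ks d * u := by
      rw [← hcoe a, ← ha]; rfl
    rw [e, Valuation.map_sub_eq_of_lt_left, map_pow, hvu]
    rw [map_mul, map_pow, hvu, ← hd2]
    exact mul_lt_of_lt_one_right (pow_pos hr0 p) hr1
  have ha0 : a ≠ 0 := by
    rintro rfl
    rw [map_zero, map_zero] at hva
    exact (pow_pos hr0 p).ne hva
  refine ⟨d ^ p / a ^ (p - 1), algebraMap K L (d / a) * u, ?_, ?_, ?_⟩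
  · have hup : u ^ p = algebraMap K L d * u + algebraMap K L a := by rw [← ha]; ring
    rw [mul_pow, hup]
    obtain ⟨k, hk⟩ : ∃ k, p = k + 1 := ⟨p - 1, (Nat.succ_pred hp.ne_zero).symm⟩
    have ha0' : algebraMap K L a ≠ 0 := by simpa using ha0
    simp only [map_div₀, map_pow, hk, Nat.add_sub_cancel]
    exact rescale_additive_identity ha0' _ _ k
  · simp only [map_div₀, map_pow, hva, ← hd2]
    have : (r ^ p) ^ p = r ^ p * (r ^ p) ^ (p - 1) := by
      rw [← pow_succ', Nat.sub_add_cancel hp.one_le]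
    rw [this, mul_div_assoc, div_self (pow_ne_zero _ (pow_pos hr0 p).ne'), mul_one, hr, ← pow_mul,
      mul_comm]
  · have e : ((algebraMap K L (d / a) * u : L) : Ks) = algebraMap K Ks (d / a) * u := rfl
    rw [e, map_mul, map_div₀, map_div₀, hva, ← hd2, hvu, div_self (pow_pos hr0 p).ne', one_mul]

include hL hπ hδ hσ in
/-- Two generators of the same extension have nearby parameters. -/
theorem parameter_sub_lt (hσ1 : σ ≠ L.val) (hδ0 : δ ≠ 0) {Δ₁ Δ₂ : K} {z₁ z₂ : L}
    (h₁ : z₁ ^ p = algebraMap K L Δ₁ * (z₁ + 1)) (h₂ : z₂ ^ p = algebraMap K L Δ₂ * (z₂ + 1))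
    (hv₁ : v (z₁ : Ks) ∉ valueSet K v) (hv : v (z₁ : Ks) = v (z₂ : Ks)) (hlt : v (z₁ : Ks) < 1) :
    v (algebraMap K Ks (Δ₂ / Δ₁) - 1) < 1 := by
  have hp : p.Prime := Fact.out
  have : CharP Ks p := charP_of_injective_algebraMap (algebraMap K Ks).injective p
  have : CharP L p := charP_of_injective_algebraMap (algebraMap K L).injective p
  have hle := map_conj_sub_le v hL hπ hδ hσ
  have hcoe : ∀ a : K, ((algebraMap K L a : L) : Ks) = algebraMap K Ks a := fun _ => rfl
  have hv0 : v (z₁ : Ks) ≠ 0 := fun h => hv₁ (h ▸ zero_mem_valueSet v)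
  have hz₁ : (z₁ : Ks) ≠ 0 := by simpa using hv0
  have hz₂ : (z₂ : Ks) ≠ 0 := by rw [hv] at hv0; simpa using hv0
  have hzK : ∀ (z : L), v (z : Ks) = v (z₁ : Ks) → σ z - (z : Ks) ≠ 0 := by
    intro z hz h
    obtain ⟨a, rfl⟩ := (conj_eq_self_iff hL hσ1 z).1 (sub_eq_zero.1 h)
    exact hv₁ (hz ▸ ⟨a, rfl⟩)
  have hroot : ∀ (Δ : K) (z : L), v (z : Ks) = v (z₁ : Ks) →
      z ^ p = algebraMap K L Δ * (z + 1) → (σ z - (z : Ks)) ^ (p - 1) = algebraMap K Ks Δ := by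
    intro Δ z hz h
    refine mul_right_cancel₀ (hzK z hz) ?_
    rw [← pow_succ, Nat.sub_add_cancel hp.one_le, sub_pow_char, ← map_pow]
    have h' : (z : Ks) ^ p = algebraMap K Ks Δ * (z + 1) := congrArg (algebraMap L Ks) h
    rw [h', h, map_mul, σ.commutes, map_add, map_one]
    ring
  have hs₁ := hroot Δ₁ z₁ rfl h₁
  have hs₂ := hroot Δ₂ z₂ hv.symm h₂
  have hn₁ := hzK z₁ rfl
  have hn₂ := hzK z₂ hv.symm
  have hvs₁ := map_conj_sub_eq v hL hπ hδ hσ hv₁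
  set s₁ := σ z₁ - (z₁ : Ks) with hs₁d
  set s₂ := σ z₂ - (z₂ : Ks) with hs₂d
  have hΔ₁ : algebraMap K Ks Δ₁ ≠ 0 := hs₁ ▸ pow_ne_zero _ hn₁
  have hvq : v ((z₂ / z₁ : L) : Ks) = 1 := by
    have e : ((z₂ / z₁ : L) : Ks) = (z₂ : Ks) / z₁ := rfl
    rw [e, map_div₀, hv, div_self (hv ▸ hv0)]
  obtain ⟨c, hc1, hc2⟩ := exists_approx_base v hL hπ (x := z₂ / z₁)
    (by intro h; rw [h] at hvq; simp at hvq) (hvq ▸ ⟨1, by simp⟩)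
  rw [hvq] at hc1 hc2
  have hc0 : algebraMap K Ks c ≠ 0 := by
    intro h
    rw [h, map_zero] at hc2
    exact one_ne_zero hc2
  have hf : v ((z₂ : Ks) / z₁ / algebraMap K Ks c - 1) < 1 := by
    rw [div_sub_one hc0, map_div₀, ← hc2, div_one]
    exact hc1
  -- `σ - 1` scales `z₁` by exactly `δ` and the error `z₂ - c * z₁` by at most `δ`, so `c`
  -- approximates `s₂ / s₁` as well as `z₂ / z₁`.
  have he : v (s₂ / s₁ / algebraMap K Ks c - 1) < 1 := by
    have e1 : s₂ / s₁ / algebraMap K Ks c - 1 =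
        (σ (z₂ - algebraMap K L c * z₁) - ((z₂ - algebraMap K L c * z₁ : L) : Ks)) /
          (s₁ * algebraMap K Ks c) := by
      have e2 : ((z₂ - algebraMap K L c * z₁ : L) : Ks) = (z₂ : Ks) - algebraMap K Ks c * z₁ := rfl
      rw [map_sub, map_mul, σ.commutes, e2]
      field_simp
      ring
    have e3 : ((z₂ - algebraMap K L c * z₁ : L) : Ks) =
        (((z₂ / z₁ : L) : Ks) - algebraMap K Ks c) * z₁ := by
      have e : ((z₂ / z₁ : L) : Ks) = (z₂ : Ks) / z₁ := rfl
      rw [e, sub_mul, div_mul_cancel₀ _ hz₁]; rfl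
    rw [e1, map_div₀, map_mul, ← hc2, mul_one, hvs₁]
    refine (div_lt_one₀ (mul_pos (zero_lt_iff.2 hδ0) (zero_lt_iff.2 hv0))).2 ?_
    refine (hle _).trans_lt (mul_lt_mul_of_pos_left ?_ (zero_lt_iff.2 hδ0))
    rw [e3, map_mul]
    exact mul_lt_of_lt_one_left (zero_lt_iff.2 hv0) hc1
  have hg : v ((1 + (z₂ : Ks)) / (1 + z₁) - 1) < 1 :=
    one_unit_div v (by rwa [add_sub_cancel_left, ← hv]) (by rwa [add_sub_cancel_left])
  have hz₁1 : (1 + z₁ : Ks) ≠ 0 := by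
    intro h
    have := Valuation.map_one_add_of_lt v hlt
    rw [h, map_zero] at this
    exact zero_ne_one this
  have hfe := one_unit_pow v (one_unit_div v hf he) p
  -- Dividing `s ^ p = Δ * s` by `z ^ p = Δ * (z + 1)` gives `s = (z + 1) * (s / z) ^ p` for both
  -- indices; the quotient exhibits `s₂ / s₁` as a product of one-units.
  have key : s₂ / s₁ = (1 + (z₂ : Ks)) / (1 + z₁) /
      ((z₂ : Ks) / z₁ / algebraMap K Ks c / (s₂ / s₁ / algebraMap K Ks c)) ^ p := by
    have h₁' : (z₁ : Ks) ^ p = algebraMap K Ks Δ₁ * (z₁ + 1) := congrArg (algebraMap L Ks) h₁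
    have h₂' : (z₂ : Ks) ^ p = algebraMap K Ks Δ₂ * (z₂ + 1) := congrArg (algebraMap L Ks) h₂
    have e4 : (z₂ : Ks) / z₁ / algebraMap K Ks c / (s₂ / s₁ / algebraMap K Ks c) =
      (z₂ * s₁) / (z₁ * s₂) := by field_simp
    have hs₁p : s₁ ^ p = algebraMap K Ks Δ₁ * s₁ := by
      rw [← hs₁, ← pow_succ, Nat.sub_add_cancel hp.one_le]
    have hs₂p : s₂ ^ p = algebraMap K Ks Δ₂ * s₂ := by
      rw [← hs₂, ← pow_succ, Nat.sub_add_cancel hp.one_le]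
    have hΔ₂ : algebraMap K Ks Δ₂ ≠ 0 := hs₂ ▸ pow_ne_zero _ hn₂
    have hz₂1 : (1 + z₂ : Ks) ≠ 0 := by
      intro h
      have := Valuation.map_one_add_of_lt v (hv ▸ hlt)
      rw [h, map_zero] at this
      exact zero_ne_one this
    rw [e4, div_pow, mul_pow, mul_pow, h₁', h₂', hs₁p, hs₂p, add_comm (z₁ : Ks), add_comm (z₂ : Ks)]
    field_simp
  have h6 := one_unit_div v hg hfe
  rw [← key] at h6
  have h5 := one_unit_pow v h6 (p - 1)
  rwa [div_pow, hs₁, hs₂, ← map_div₀] at h5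

end Generator

end LocalFieldExt

namespace LocalFieldExt

open scoped NNReal
open IsNonarchimedeanLocalField

/-! ### The absolute value of a local field and its extension to `Ks`. -/

section LocalField

variable (K : Type*) [Field K] [ValuativeRel K] [TopologicalSpace K]
  [IsNonarchimedeanLocalField K]

/-- The embedding of the value group of a local field into the nonnegative reals. -/
noncomputable def valueEmbedding : ValuativeRel.ValueGroupWithZero K →*₀ ℝ≥0 :=
  (WithZeroMulInt.toNNReal (e := 2) two_ne_zero).comp
    (valueGroupWithZeroIsoInt K).toMulEquiv.toMonoidWithZeroHom

theorem valueEmbedding_strictMono : StrictMono (valueEmbedding K) :=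
  (WithZeroMulInt.toNNReal_strictMono (e := 2) one_lt_two).comp
    (valueGroupWithZeroIsoInt K).strictMono

/-- The normalized absolute value of a local field turns it into a normed field. -/
@[reducible] noncomputable def localNormedField : NontriviallyNormedField K :=
  let := IsTopologicalAddGroup.rightUniformSpace K
  have := isUniformAddGroup_of_addCommGroup (G := K)
  let : (Valued.v (R := K) (Γ₀ := ValuativeRel.ValueGroupWithZero K)).RankOne :=
  { hom' := (valueEmbedding K).comp MonoidWithZeroHom.ValueGroup₀.embedding
    strictMono' := (valueEmbedding_strictMono K).comp
        MonoidWithZeroHom.ValueGroup₀.embedding_strictMono }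
  Valued.toNontriviallyNormedField K (ValuativeRel.ValueGroupWithZero K)

theorem localNormedField_complete :
    @CompleteSpace K (localNormedField K).toUniformSpace := by
  let := IsTopologicalAddGroup.rightUniformSpace K
  have := isUniformAddGroup_of_addCommGroup (G := K)
  exact inferInstanceAs (CompleteSpace K)

theorem localNormedField_ultrametric :
    @IsUltrametricDist K (localNormedField K).toDist := by
  let := IsTopologicalAddGroup.rightUniformSpace K
  have := isUniformAddGroup_of_addCommGroup (G := K)
  let : (Valued.v (R := K) (Γ₀ := ValuativeRel.ValueGroupWithZero K)).RankOne :=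
  { hom' := (valueEmbedding K).comp MonoidWithZeroHom.ValueGroup₀.embedding
    strictMono' := (valueEmbedding_strictMono K).comp
        MonoidWithZeroHom.ValueGroup₀.embedding_strictMono }
  let := Valued.toNormedField K (ValuativeRel.ValueGroupWithZero K)
  exact inferInstanceAs (IsUltrametricDist K)

theorem localNormedField_norm (x : K) :
    (localNormedField K).norm x = valueEmbedding K (ValuativeRel.valuation K x) := by
  let := IsTopologicalAddGroup.rightUniformSpace K
  have := isUniformAddGroup_of_addCommGroup (G := K)
  change ((valueEmbedding K (MonoidWithZeroHom.ValueGroup₀.embedding _) : ℝ≥0) : ℝ) = _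
  erw [MonoidWithZeroHom.ValueGroup₀.embedding_restrict₀]
  rfl

theorem valueEmbedding_eq {x : K} (hx : x ≠ 0) :
    valueEmbedding K (ValuativeRel.valuation K x) = 2 ^ (-ord K x) := by
  have h : valueGroupWithZeroIsoInt K (ValuativeRel.valuation K x) ≠ 0 := by simpa using hx
  change WithZeroMulInt.toNNReal (e := 2) two_ne_zero (valueGroupWithZeroIsoInt K (ValuativeRel.valuation K x)) = _
  rw [WithZeroMulInt.toNNReal_neg_apply _ h, ord, neg_neg]
  congr 1
  obtain ⟨a, ha⟩ := WithZero.ne_zero_iff_exists.1 h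
  simp only [← ha]
  rfl

variable (Ks : Type*) [Field Ks] [Algebra K Ks] [Algebra.IsAlgebraic K Ks]

/-- The absolute value of an algebraic extension of `K` that extends the normalized one of `K`. -/
noncomputable def extVal : Valuation Ks ℝ≥0 :=
  let := localNormedField K
  have := localNormedField_complete K
  have := localNormedField_ultrametric K
  { toFun := fun x => ⟨spectralNorm K Ks x, spectralNorm_nonneg x⟩
    map_zero' := Subtype.ext spectralNorm_zero
    map_one' := Subtype.ext spectralNorm_one
    map_mul' := fun x y => Subtype.ext ((spectralMulAlgNorm K Ks).map_mul' x y)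
    map_add_le_max' := fun x y => isNonarchimedean_spectralNorm x y }

variable {K Ks}

/-- The spectral norm is the norm of the constant coefficient of the minimal polynomial, to the
power one over the degree, which is the recipe for `nu`. The base `2` is an arbitrary choice. -/
theorem extVal_eq {x : Ks} (hx : x ≠ 0) :
    extVal K Ks x = (2 : ℝ≥0) ^ (-(nu K x : ℝ)) := by
  let := localNormedField K
  have := localNormedField_complete K
  have := localNormedField_ultrametric K
  have h : ((extVal K Ks x : ℝ≥0) : ℝ) = spectralNorm K Ks x := rfl
  have hc : (minpoly K x).coeff 0 ≠ 0 :=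
    minpoly.coeff_zero_ne_zero (Algebra.IsIntegral.isIntegral x) hx
  rw [← NNReal.coe_inj, h, spectralNorm.spectralNorm_eq_norm_coeff_zero_rpow]
  have h2 : ‖(minpoly K x).coeff 0‖ = _ := localNormedField_norm K _
  rw [h2, valueEmbedding_eq K hc, nu]
  push_cast
  rw [← Real.rpow_intCast, ← Real.rpow_mul (by norm_num)]
  congr 1
  push_cast
  ring

omit [Algebra.IsAlgebraic K Ks] in
theorem nu_algebraMap (x : K) : nu K (algebraMap K Ks x) = ord K x := by
  simp [nu, minpoly.eq_X_sub_C, ord]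

theorem extVal_algebraMap {x : K} (hx : x ≠ 0) :
    extVal K Ks (algebraMap K Ks x) = (2 : ℝ≥0) ^ (-ord K x) := by
  rw [extVal_eq (by simpa using hx), nu_algebraMap, ← NNReal.rpow_intCast]
  congr 1
  push_cast
  ring

/-- Finite-dimensional subspaces over the complete field `K` are closed; no completeness of `Ks` is
needed. -/
theorem mem_of_forall_close (W : Submodule K Ks) (hW : FiniteDimensional K W) (s : Ks)
    (hs : ∀ ε : ℝ≥0, 0 < ε → ∃ w ∈ W, extVal K Ks (s - w) < ε) : s ∈ W := by
  let := localNormedField K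
  have := localNormedField_complete K
  have := localNormedField_ultrametric K
  let := spectralNorm.normedField K Ks
  let := spectralNorm.normedAlgebra K Ks
  have hcl : IsClosed (W : Set Ks) := Submodule.closed_of_finiteDimensional W
  have : s ∈ closure (W : Set Ks) := by
    rw [Metric.mem_closure_iff]
    intro ε hε
    obtain ⟨w, hw, h⟩ := hs ⟨ε, hε.le⟩ hε
    exact ⟨w, hw, h⟩
  rwa [hcl.closure_eq] at this

end LocalField
end LocalFieldExt

namespace LocalFieldExt

open scoped NNReal
open IsNonarchimedeanLocalField

/-! ### From `ord`, `nu` and breaks to absolute values. -/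

section Values

variable {K : Type*} [Field K] [ValuativeRel K] [TopologicalSpace K]
  [IsNonarchimedeanLocalField K]

theorem valueEmbedding_lt_one_iff (x : K) :
    valueEmbedding K (ValuativeRel.valuation K x) < 1 ↔ ValuativeRel.valuation K x < 1 := by
  rw [← (valueEmbedding_strictMono K).lt_iff_lt, map_one]

theorem ord_mul {x y : K} (hx : x ≠ 0) (hy : y ≠ 0) : ord K (x * y) = ord K x + ord K y := by
  have hx' : valueGroupWithZeroIsoInt K (ValuativeRel.valuation K x) ≠ 0 := by simpa using hx
  have hy' : valueGroupWithZeroIsoInt K (ValuativeRel.valuation K y) ≠ 0 := by simpa using hy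
  rw [ord, map_mul, map_mul, WithZero.log_mul hx' hy', neg_add]
  rfl

theorem ord_inv (x : K) : ord K x⁻¹ = -ord K x := by
  rw [ord, map_inv₀, map_inv₀, WithZero.log_inv, ord]

theorem ord_pow (x : K) (k : ℕ) : ord K (x ^ k) = k * ord K x := by
  rw [ord, map_pow, map_pow, WithZero.log_pow, ord]
  simp

theorem ord_div {x y : K} (hx : x ≠ 0) (hy : y ≠ 0) : ord K (x / y) = ord K x - ord K y := by
  rw [div_eq_mul_inv, ord_mul hx (inv_ne_zero hy), ord_inv, sub_eq_add_neg]

theorem ord_zpow (x : K) (k : ℤ) : ord K (x ^ k) = k * ord K x := by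
  rw [ord, map_zpow₀, map_zpow₀, WithZero.log_zpow, ord]
  simp

variable (K) in
theorem exists_ord_eq (m : ℤ) : ∃ t : K, t ≠ 0 ∧ ord K t = m := by
  obtain ⟨t, ht⟩ := ValuativeRel.valuation_surjective
    ((valueGroupWithZeroIsoInt K).symm (WithZero.exp (-m)))
  refine ⟨t, ?_, ?_⟩
  · rintro rfl
    have := congrArg (valueGroupWithZeroIsoInt K) ht
    simp only [map_zero, OrderMonoidIso.apply_symm_apply] at this
    exact WithZero.exp_ne_zero this.symm
  · rw [ord, ht]
    simp

theorem valuation_eq_one_iff {x : K} (hx : x ≠ 0) :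
    ValuativeRel.valuation K x = 1 ↔ ord K x = 0 := by
  rw [← (valueEmbedding_strictMono K).injective.eq_iff, map_one, valueEmbedding_eq K hx,
    zpow_eq_one_iff_right₀ zero_le (by norm_num), neg_eq_zero]

variable {Ks : Type*} [Field Ks] [Algebra K Ks] [Algebra.IsAlgebraic K Ks]

theorem extVal_algebraMap' (x : K) :
    extVal K Ks (algebraMap K Ks x) = valueEmbedding K (ValuativeRel.valuation K x) := by
  by_cases hx : x = 0
  · simp [hx]
  · rw [extVal_algebraMap hx, valueEmbedding_eq K hx]

theorem extVal_algebraMap_lt_one_iff (x : K) :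
    extVal K Ks (algebraMap K Ks x) < 1 ↔ ValuativeRel.valuation K x < 1 := by
  rw [extVal_algebraMap', valueEmbedding_lt_one_iff]

theorem mem_valueSet_iff (r : ℝ≥0) :
    r ∈ valueSet K (extVal K Ks) ↔ r = 0 ∨ ∃ m : ℤ, r = 2 ^ m := by
  constructor
  · rintro ⟨a, rfl⟩
    by_cases ha : a = 0
    · simp [ha]
    · exact Or.inr ⟨_, extVal_algebraMap ha⟩
  · rintro (rfl | ⟨m, rfl⟩)
    · exact zero_mem_valueSet _
    · obtain ⟨t, ht0, ht⟩ := exists_ord_eq K (-m)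
      exact ⟨t, by simp only [extVal_algebraMap ht0, ht, neg_neg]⟩

theorem two_rpow_injective : Function.Injective fun r : ℝ => (2 : ℝ≥0) ^ r := fun r s h =>
  (Real.strictMono_rpow_of_base_gt_one one_lt_two).injective (by
    have := congrArg ((↑) : ℝ≥0 → ℝ) h
    simpa using this)

theorem two_rpow_div_notMem_valueSet {p : ℕ} (hp : p ≠ 0) {k : ℤ} (hk : ¬ (p : ℤ) ∣ k) :
    (2 : ℝ≥0) ^ ((k : ℝ) / p) ∉ valueSet K (extVal K Ks) := by
  rw [mem_valueSet_iff]
  rintro (h | ⟨m, h⟩)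
  · exact (NNReal.rpow_pos two_pos).ne' h
  · rw [← NNReal.rpow_intCast] at h
    have h2 := two_rpow_injective h
    refine hk ⟨m, ?_⟩
    have hp' : (p : ℝ) ≠ 0 := by exact_mod_cast hp
    field_simp at h2
    exact_mod_cast h2

theorem nu_eq_iff {x : Ks} (hx : x ≠ 0) (r : ℚ) :
    nu K x = r ↔ extVal K Ks x = (2 : ℝ≥0) ^ (-(r : ℝ)) := by
  rw [extVal_eq hx]
  constructor
  · rintro rfl; rfl
  · intro h
    have := two_rpow_injective h
    exact_mod_cast neg_injective this

theorem nu_mul {x y : Ks} (hx : x ≠ 0) (hy : y ≠ 0) : nu K (x * y) = nu K x + nu K y := by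
  rw [nu_eq_iff (mul_ne_zero hx hy), map_mul, extVal_eq hx, extVal_eq hy,
    ← NNReal.rpow_add two_ne_zero]
  push_cast
  congr 1
  ring

theorem nu_pow {x : Ks} (hx : x ≠ 0) (k : ℕ) : nu K (x ^ k) = k * nu K x := by
  rw [nu_eq_iff (pow_ne_zero k hx), map_pow, extVal_eq hx, ← NNReal.rpow_natCast,
    ← NNReal.rpow_mul]
  push_cast
  congr 1
  ring

/-- The value of a ramified break in terms of absolute values. -/
theorem exists_conj_of_mem_extensions {p : ℕ} [Fact p.Prime] {b : ℚ} {L : IntermediateField K Ks}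
    (hb : b ≠ -1) (hL : L ∈ extensions K Ks p b) :
    Module.finrank K L = p ∧ ∃ σ : L →ₐ[K] Ks, σ ≠ L.val ∧ ∃ π : L,
      extVal K Ks (π : Ks) = 2 ^ (-(1 : ℝ) / p) ∧
      extVal K Ks (σ π - (π : Ks)) = 2 ^ (-(b : ℝ) / p) * extVal K Ks (π : Ks) := by
  obtain ⟨h1, -, σ, hσ, π, hπ, hbr⟩ := hL
  have hp : (p : ℚ) ≠ 0 := by exact_mod_cast (Fact.out : p.Prime).ne_zero
  have hp' : (p : ℝ) ≠ 0 := by exact_mod_cast (Fact.out : p.Prime).ne_zero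
  rw [nuOf, h1] at hπ hbr
  have hnu0 : nu K (0 : Ks) = 0 := by
    simp [nu, ord]
  have hπ0 : (π : Ks) ≠ 0 := by
    intro h
    rw [h, hnu0] at hπ
    simp at hπ
  -- If `σ π = π`, the junk value `nu 0 = 0` would give the break `-1`.
  have hd0 : σ π - (π : Ks) ≠ 0 := by
    intro h
    rw [h, hnu0] at hbr
    apply hb
    rw [← hbr]; ring
  have e1 : nu K (π : Ks) = 1 / p := by field_simp; linarith
  have e2 : nu K (σ π - (π : Ks)) = (b + 1) / p := by
    rw [← hbr]; field_simp; ring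
  refine ⟨h1, σ, hσ, π, ?_, ?_⟩
  · rw [(nu_eq_iff hπ0 _).1 e1]
    push_cast
    congr 1
    ring
  · rw [(nu_eq_iff hd0 _).1 e2, (nu_eq_iff hπ0 _).1 e1, ← NNReal.rpow_add two_ne_zero]
    push_cast
    congr 1
    ring

variable {p : ℕ} [Fact p.Prime]

theorem pow_notMem_valueSet {π : Ks} (hπ : extVal K Ks π = 2 ^ (-(1 : ℝ) / p)) (i : ℕ)
    (hi : ¬ p ∣ i) : extVal K Ks π ^ i ∉ valueSet K (extVal K Ks) := by
  have h := two_rpow_div_notMem_valueSet (K := K) (Ks := Ks) (Fact.out : p.Prime).ne_zero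
    (k := -(i : ℤ)) (by rwa [dvd_neg, Int.natCast_dvd_natCast])
  rw [hπ, ← NNReal.rpow_natCast, ← NNReal.rpow_mul]
  convert h using 2
  push_cast
  ring_nf

variable [CharP K p] {b : ℚ} {n : ℕ} (hn : ¬ p ∣ n) (hb : b = (n : ℚ) / ((p : ℚ) - 1))

include hn hb in
theorem break_pos : 0 < b := by
  have hp : p.Prime := Fact.out
  have hn0 : 0 < n := Nat.pos_of_ne_zero fun h => hn (h ▸ dvd_zero p)
  have hp1 : (1 : ℚ) < p := by exact_mod_cast hp.one_lt
  rw [hb]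
  exact div_pos (by exact_mod_cast hn0) (by linarith)

theorem rpow_break_lt_one {p : ℕ} [Fact p.Prime] {b : ℚ} (hb : 0 < b) :
    (2 : ℝ≥0) ^ (-(b : ℝ) / p) < 1 := by
  have hp : (0 : ℝ) < p := by exact_mod_cast (Fact.out : p.Prime).pos
  have hb' : (0 : ℝ) < b := by exact_mod_cast hb
  refine NNReal.rpow_lt_one_of_one_lt_of_neg one_lt_two ?_
  exact div_neg_of_neg_of_pos (by linarith) hp

include hn hb in
-- `exists_generator` applies with `δ = 2 ^ (-b / p)` and `v π = 2 ^ (-1 / p)`: the relation `δ ^ (p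
-- - 1) = v π ^ n` is `(p - 1) b = n`.
theorem exists_parameter [IsSepClosure K Ks] {L : IntermediateField K Ks}
    (hL : L ∈ extensions K Ks p b) :
    ∃ (Δ : K) (z : Ks), Δ ≠ 0 ∧ ord K Δ = n ∧ z ^ p = algebraMap K Ks Δ * (z + 1) ∧
      L = IntermediateField.adjoin K {z} := by
  have hp : p.Prime := Fact.out
  have hb0 := break_pos hn hb
  have : CharP Ks p := charP_of_injective_algebraMap (algebraMap K Ks).injective p
  obtain ⟨hdeg, σ, hσ1, π, hvπ, hσ⟩ := exists_conj_of_mem_extensions (by linarith) hL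
  have hπ := pow_notMem_valueSet (K := K) hvπ
  have hpR : (p : ℝ) ≠ 0 := by exact_mod_cast hp.ne_zero
  have hp1R : (p : ℝ) - 1 ≠ 0 := by
    have : (1 : ℝ) < p := by exact_mod_cast hp.one_lt
    linarith
  have hsep : IsSepClosed Ks := IsSepClosure.sep_closed K
  obtain ⟨Δ, z, hz, hvΔ, hvz⟩ := exists_generator (extVal K Ks) hdeg hπ
    (rpow_break_lt_one hb0) hσ hσ1 (NNReal.rpow_pos two_pos).ne'
    (by
      intro d _
      have : NeZero ((p - 1 : ℕ) : Ks) := ⟨by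
        rw [Nat.cast_sub hp.one_le, CharP.cast_eq_zero Ks p]
        simp⟩
      exact IsSepClosed.exists_pow_nat_eq _ (p - 1))
    mem_of_forall_close hn
    (by
      rw [hvπ, ← NNReal.rpow_natCast, ← NNReal.rpow_mul, div_mul_cancel₀ _ hpR,
        mem_valueSet_iff]
      exact Or.inr ⟨-1, by rw [← NNReal.rpow_intCast]; norm_num⟩)
    (by
      rw [hvπ, ← NNReal.rpow_natCast, ← NNReal.rpow_mul, ← NNReal.rpow_natCast, ← NNReal.rpow_mul,
        hb, Nat.cast_sub hp.one_le]
      congr 1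
      push_cast
      field_simp)
  have hΔ0 : Δ ≠ 0 := by
    rintro rfl
    rw [map_zero, map_zero, hvπ] at hvΔ
    exact (pow_pos (NNReal.rpow_pos two_pos) _).ne hvΔ
  refine ⟨Δ, z, hΔ0, ?_, congrArg (algebraMap L Ks) hz, ?_⟩
  · rw [extVal_algebraMap hΔ0, hvπ, ← NNReal.rpow_natCast, ← NNReal.rpow_mul,
      ← NNReal.rpow_intCast] at hvΔ
    have h := two_rpow_injective hvΔ
    push_cast at h
    field_simp at h
    have h3 : ((ord K Δ : ℤ) : ℝ) = (n : ℤ) := by push_cast; linarith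
    exact_mod_cast h3
  · refine (adjoin_simple_eq_of_finrank_prime hdeg ?_).symm
    rintro a rfl
    exact hπ n hn (hvz ▸ ⟨a, rfl⟩)

include hn hb in
theorem parameter_congr {L : IntermediateField K Ks}
    (hL : L ∈ extensions K Ks p b) {Δ₁ Δ₂ : K} {z₁ z₂ : L}
    (h₁ : z₁ ^ p = algebraMap K L Δ₁ * (z₁ + 1)) (h₂ : z₂ ^ p = algebraMap K L Δ₂ * (z₂ + 1))
    (hv₁ : nu K (z₁ : Ks) = n / p) (hv₂ : nu K (z₂ : Ks) = n / p)  :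
    ValuativeRel.valuation K (Δ₂ / Δ₁ - 1) < 1 := by
  have hp : p.Prime := Fact.out
  have hpQ : (p : ℚ) ≠ 0 := by exact_mod_cast hp.ne_zero
  have hn0 : 0 < n := Nat.pos_of_ne_zero fun h => hn (h ▸ dvd_zero p)
  have hb0 := break_pos hn hb
  obtain ⟨hdeg, σ, hσ1, π, hvπ, hσ⟩ := exists_conj_of_mem_extensions (by linarith) hL
  have hπ := pow_notMem_valueSet (K := K) hvπ
  have hne : ∀ z : Ks, nu K z = n / p → z ≠ 0 := by
    rintro z hz rfl
    simp only [nu, minpoly.zero, ord, Polynomial.coeff_X_zero, map_zero, WithZero.log_zero] at hz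
    have : (n : ℚ) / p ≠ 0 := div_ne_zero (by exact_mod_cast hn0.ne') hpQ
    simp at hz
    exact hn0.ne' (by simpa [hp.ne_zero] using hz.symm)
  have e₁ := (nu_eq_iff (hne _ hv₁) _).1 hv₁
  have e₂ := (nu_eq_iff (hne _ hv₂) _).1 hv₂
  have h := parameter_sub_lt (extVal K Ks) hdeg hπ (rpow_break_lt_one hb0) hσ hσ1
    (NNReal.rpow_pos two_pos).ne' h₁ h₂ (by
      rw [e₁]
      have := two_rpow_div_notMem_valueSet (K := K) (Ks := Ks) hp.ne_zero
        (k := -(n : ℤ)) (by rwa [dvd_neg, Int.natCast_dvd_natCast])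
      convert this using 2
      push_cast
      ring_nf) (e₁.trans e₂.symm) (by
      rw [e₁]
      refine NNReal.rpow_lt_one_of_one_lt_of_neg one_lt_two ?_
      rw [neg_lt_zero]
      have : (0 : ℚ) < n / p := div_pos (by exact_mod_cast hn0) (by exact_mod_cast hp.pos)
      exact_mod_cast this)
  rwa [← map_one (algebraMap K Ks), ← map_sub, extVal_algebraMap_lt_one_iff] at h

end Values
end LocalFieldExt

namespace LocalFieldExt

open scoped NNReal
open IsNonarchimedeanLocalField Polynomial

/-! ### Every parameter of order `n` gives an extension with break `b`. -/

section Roots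

variable {K : Type*} [Field K] [ValuativeRel K] [TopologicalSpace K]
  [IsNonarchimedeanLocalField K] {Ks : Type*} [Field Ks] [Algebra K Ks]
  {p : ℕ} [Fact p.Prime] {n : ℕ} {Δ : K} {z : Ks}

/-- The polynomial `X ^ p - Δ * X - Δ`. -/
noncomputable def parameterPoly (p : ℕ) {K : Type*} [Field K] (Δ : K) : K[X] :=
  X ^ p - (C Δ * X + C Δ)

omit [ValuativeRel K] [TopologicalSpace K] [IsNonarchimedeanLocalField K] in
theorem parameterPoly_degree_lt (Δ : K) : (C Δ * X + C Δ : K[X]).degree < p :=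
  Polynomial.degree_linear_le.trans_lt (by exact_mod_cast (Fact.out : p.Prime).one_lt)

omit [ValuativeRel K] [TopologicalSpace K] [IsNonarchimedeanLocalField K] in
theorem parameterPoly_monic (Δ : K) : (parameterPoly p Δ).Monic :=
  monic_X_pow_sub (parameterPoly_degree_lt Δ)

omit [ValuativeRel K] [TopologicalSpace K] [IsNonarchimedeanLocalField K] in
theorem parameterPoly_natDegree (Δ : K) : (parameterPoly p Δ).natDegree = p := by
  refine natDegree_eq_of_degree_eq_some ?_
  rw [parameterPoly, degree_sub_eq_left_of_degree_lt, degree_X_pow]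
  rw [degree_X_pow]
  exact parameterPoly_degree_lt Δ

omit [ValuativeRel K] [TopologicalSpace K] [IsNonarchimedeanLocalField K] [Fact p.Prime] in
theorem aeval_parameterPoly {A : Type*} [CommRing A] [Algebra K A] (Δ : K) (x : A) :
    aeval x (parameterPoly p Δ) = x ^ p - algebraMap K A Δ * (x + 1) := by
  simp [parameterPoly, mul_add]

omit [ValuativeRel K] [TopologicalSpace K] [IsNonarchimedeanLocalField K] in
-- In characteristic `p` the derivative is the nonzero constant `-Δ`, so the polynomial is
-- separable.
theorem exists_root_parameterPoly [CharP K p] [IsSepClosure K Ks] (hΔ : Δ ≠ 0) :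
    ∃ z : Ks, z ^ p = algebraMap K Ks Δ * (z + 1) := by
  have hsep : IsSepClosed Ks := IsSepClosure.sep_closed K
  have hp : p.Prime := Fact.out
  have hs : (parameterPoly p Δ).Separable := by
    have hd : derivative (parameterPoly p Δ) = C (-Δ) := by
      simp [parameterPoly, derivative_X_pow]
    rw [separable_def, hd]
    exact ⟨0, C (-Δ)⁻¹, by rw [zero_mul, zero_add, ← C_mul, inv_mul_cancel₀ (neg_ne_zero.2 hΔ), C_1]⟩
  obtain ⟨z, hz⟩ := IsSepClosed.exists_aeval_eq_zero Ks (parameterPoly p Δ) (by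
    rw [degree_eq_natDegree (parameterPoly_monic Δ).ne_zero, parameterPoly_natDegree]
    exact_mod_cast hp.ne_zero) hs
  exact ⟨z, by rwa [aeval_parameterPoly, sub_eq_zero] at hz⟩

omit [ValuativeRel K] [TopologicalSpace K] [IsNonarchimedeanLocalField K] in
theorem parameter_root_ne_zero (hΔ : Δ ≠ 0) (hz : z ^ p = algebraMap K Ks Δ * (z + 1)) :
    z ≠ 0 := by
  rintro rfl
  rw [zero_pow (Fact.out : p.Prime).ne_zero, zero_add, mul_one, eq_comm] at hz
  exact hΔ (by simpa using hz)

theorem nu_parameter_root [Algebra.IsAlgebraic K Ks] (hn : 0 < n) (hΔ : Δ ≠ 0)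
    (hord : ord K Δ = n) (hz : z ^ p = algebraMap K Ks Δ * (z + 1)) : nu K z = n / p := by
  have hp : p.Prime := Fact.out
  have hv := congrArg (extVal K Ks) hz
  have hz0 := parameter_root_ne_zero hΔ hz
  have hΔ1 : extVal K Ks (algebraMap K Ks Δ) < 1 := by
    rw [extVal_algebraMap hΔ, hord, zpow_neg, inv_lt_one₀ (by positivity), zpow_natCast]
    exact one_lt_pow₀ one_lt_two hn.ne'
  rw [map_pow, map_mul] at hv
  -- Once this is known, `z + 1` has value `1` and the equation reads `p * nu z = n`.
  have hlt : extVal K Ks z < 1 := by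
    by_contra! hge
    have h1 : extVal K Ks (z + 1) ≤ extVal K Ks z :=
      Valuation.map_add_le _ le_rfl (by rwa [map_one])
    have h2 : extVal K Ks z ≤ extVal K Ks z ^ p := le_self_pow₀ hge hp.ne_zero
    have h3 : extVal K Ks (algebraMap K Ks Δ) * extVal K Ks (z + 1) < extVal K Ks z :=
      (mul_le_mul_right h1 _).trans_lt (mul_lt_of_lt_one_left (one_pos.trans_le hge) hΔ1)
    exact absurd (h2.trans hv.le) (not_le.2 h3)
  rw [add_comm, Valuation.map_one_add_of_lt _ hlt, mul_one, ← map_pow, extVal_algebraMap hΔ,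
    hord] at hv
  have hnu := (nu_eq_iff (K := K) (pow_ne_zero p hz0) n).2 (by
    rw [hv, ← NNReal.rpow_intCast]; push_cast; rfl)
  rw [nu_pow hz0] at hnu
  have : (p : ℚ) ≠ 0 := by exact_mod_cast hp.ne_zero
  field_simp
  linarith

/-- `nu z = n / p` is a fraction in lowest terms whose denominator must divide the degree of `z`. -/
theorem minpoly_parameter_root [Algebra.IsAlgebraic K Ks] (hn : ¬ p ∣ n) (hΔ : Δ ≠ 0)
    (hord : ord K Δ = n) (hz : z ^ p = algebraMap K Ks Δ * (z + 1)) :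
    minpoly K z = parameterPoly p Δ := by
  have hp : p.Prime := Fact.out
  have hn0 : 0 < n := Nat.pos_of_ne_zero fun h => hn (h ▸ dvd_zero p)
  have hroot : aeval z (parameterPoly p Δ) = 0 := by
    rw [aeval_parameterPoly, hz, sub_self]
  have hint : IsIntegral K z := Algebra.IsIntegral.isIntegral z
  have hnu := nu_parameter_root hn0 hΔ hord hz
  refine (eq_of_monic_of_dvd_of_natDegree_le (minpoly.monic hint) (parameterPoly_monic Δ)
    (minpoly.dvd _ _ hroot) ?_).symm
  rw [parameterPoly_natDegree]
  have hd := minpoly.natDegree_pos hint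
  refine Nat.le_of_dvd hd ?_
  rw [nu, div_eq_div_iff (by exact_mod_cast hd.ne') (by exact_mod_cast hp.ne_zero)] at hnu
  have h2 : (p : ℤ) ∣ (n : ℤ) * (minpoly K z).natDegree :=
    ⟨ord K ((minpoly K z).coeff 0), by rw [mul_comm (p : ℤ)]; exact_mod_cast hnu.symm⟩
  have h3 : p ∣ n * (minpoly K z).natDegree := by exact_mod_cast h2
  exact (hp.dvd_mul.1 h3).resolve_left hn

theorem finrank_adjoin_parameter_root [Algebra.IsAlgebraic K Ks] (hn : ¬ p ∣ n) (hΔ : Δ ≠ 0)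
    (hord : ord K Δ = n) (hz : z ^ p = algebraMap K Ks Δ * (z + 1)) :
    Module.finrank K (IntermediateField.adjoin K {z}) = p := by
  rw [IntermediateField.adjoin.finrank (Algebra.IsIntegral.isIntegral z),
    minpoly_parameter_root hn hΔ hord hz, parameterPoly_natDegree]

/-- These are the exponents for which `z ^ i * t ^ j` is a prime element of `K(z)`. -/
theorem exists_mul_eq_one_add (hn : ¬ p ∣ n) :
    ∃ (i : ℕ) (j : ℤ), ¬ p ∣ i ∧ (i : ℤ) * n + p * j = 1 := by
  have hp : p.Prime := Fact.out
  have hn' : (n : ZMod p) ≠ 0 := by rwa [Ne, ZMod.natCast_eq_zero_iff]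
  have h1 : (((n : ZMod p)⁻¹.val * n : ℤ) : ZMod p) = 1 := by
    push_cast
    rw [ZMod.natCast_zmod_val, inv_mul_cancel₀ hn']
  have h2 : ((1 - (n : ZMod p)⁻¹.val * n : ℤ) : ZMod p) = 0 := by
    rw [Int.cast_sub, h1]; simp
  rw [ZMod.intCast_zmod_eq_zero_iff_dvd] at h2
  obtain ⟨j, hj⟩ := h2
  refine ⟨(n : ZMod p)⁻¹.val, j, ?_, by rw [← hj]; ring⟩
  intro hd
  have := (ZMod.natCast_eq_zero_iff _ _).2 hd
  rw [ZMod.natCast_zmod_val] at this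
  exact inv_ne_zero hn' this

theorem nu_mem_of_finrank_prime [Algebra.IsAlgebraic K Ks] {L : IntermediateField K Ks}
    (hL : Module.finrank K L = p) {x : Ks} (hx : x ∈ L) : ∃ m : ℤ, nu K x = m / p := by
  have hp : p.Prime := Fact.out
  have hint : IsIntegral K x := Algebra.IsIntegral.isIntegral x
  have hle : IntermediateField.adjoin K {x} ≤ L := by
    rwa [IntermediateField.adjoin_simple_le_iff]
  have hdvd : Module.finrank K (IntermediateField.adjoin K {x}) ∣ p := by
    rw [← hL]; exact IntermediateField.finrank_dvd_of_le_right hle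
  rw [IntermediateField.adjoin.finrank hint] at hdvd
  rcases (Nat.dvd_prime hp).1 hdvd with h | h
  · refine ⟨p * ord K ((minpoly K x).coeff 0), ?_⟩
    have : (p : ℚ) ≠ 0 := by exact_mod_cast hp.ne_zero
    rw [nu, h]
    push_cast
    field_simp
  · exact ⟨ord K ((minpoly K x).coeff 0), by rw [nu, h]⟩

variable [CharP K p]

omit [ValuativeRel K] [TopologicalSpace K] [IsNonarchimedeanLocalField K] in
theorem parameter_root_add {s : Ks} (hz : z ^ p = algebraMap K Ks Δ * (z + 1))
    (hs : s ^ (p - 1) = algebraMap K Ks Δ) :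
    (z + s) ^ p = algebraMap K Ks Δ * (z + s + 1) := by
  have : CharP Ks p := charP_of_injective_algebraMap (algebraMap K Ks).injective p
  have hsp : s ^ p = algebraMap K Ks Δ * s := by
    rw [← hs, ← pow_succ, Nat.sub_add_cancel (Fact.out : p.Prime).one_le]
  rw [add_pow_char, hz, hsp]
  ring

omit [ValuativeRel K] [TopologicalSpace K] [IsNonarchimedeanLocalField K] in
theorem exists_root_pow_pred [IsSepClosure K Ks] (Δ : K) :
    ∃ s : Ks, s ^ (p - 1) = algebraMap K Ks Δ := by
  have hsep : IsSepClosed Ks := IsSepClosure.sep_closed K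
  have : CharP Ks p := charP_of_injective_algebraMap (algebraMap K Ks).injective p
  have : NeZero ((p - 1 : ℕ) : Ks) := ⟨by
    rw [Nat.cast_sub (Fact.out : p.Prime).one_le, CharP.cast_eq_zero Ks p]
    simp⟩
  exact IsSepClosed.exists_pow_nat_eq _ (p - 1)

/-- The embedding `z ↦ z + s`, where `s ^ (p - 1) = Δ`, moves the prime element `P = z ^ i * t ^ j`
by `P * ((1 + s / z) ^ i - 1)`. As `p` does not divide `i`, the second factor has the value of `s /
z`, and `nu (s / z) = n / (p - 1) - n / p = b / p`. -/
theorem adjoin_mem_extensions [IsSepClosure K Ks] {b : ℚ} (hn : ¬ p ∣ n)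
    (hb : b = (n : ℚ) / ((p : ℚ) - 1)) (hΔ : Δ ≠ 0) (hord : ord K Δ = n)
    (hz : z ^ p = algebraMap K Ks Δ * (z + 1)) :
    IntermediateField.adjoin K {z} ∈ extensions K Ks p b := by
  have hp : p.Prime := Fact.out
  have hpQ : (p : ℚ) ≠ 0 := by exact_mod_cast hp.ne_zero
  have hp1Q : (0 : ℚ) < (p : ℚ) - 1 := by
    have : (1 : ℚ) < p := by exact_mod_cast hp.one_lt
    linarith
  have : CharP Ks p := charP_of_injective_algebraMap (algebraMap K Ks).injective p
  have hn0 : 0 < n := Nat.pos_of_ne_zero fun h => hn (h ▸ dvd_zero p)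
  have hint : IsIntegral K z := Algebra.IsIntegral.isIntegral z
  have hnu := nu_parameter_root hn0 hΔ hord hz
  have hdeg := finrank_adjoin_parameter_root hn hΔ hord hz
  have hz0 := parameter_root_ne_zero hΔ hz
  have hmem := IntermediateField.mem_adjoin_simple_self K z
  obtain ⟨i, j, hi, hij⟩ := exists_mul_eq_one_add hn
  obtain ⟨t, ht0, ht⟩ := exists_ord_eq K 1
  have hnut : ∀ k : ℤ, nu K (algebraMap K Ks (t ^ k)) = k := by
    intro k
    rw [nu_algebraMap, ord_zpow, ht, mul_one]
  have htz : ∀ k : ℤ, algebraMap K Ks (t ^ k) ≠ 0 := fun k => (_root_.map_ne_zero _).2 (zpow_ne_zero k ht0)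
  set P : Ks := z ^ i * algebraMap K Ks (t ^ j) with hP
  have hPmem : P ∈ IntermediateField.adjoin K {z} :=
    mul_mem (pow_mem hmem i) (IntermediateField.algebraMap_mem _ _)
  have hP0 : P ≠ 0 := mul_ne_zero (pow_ne_zero i hz0) (htz j)
  have hnuP : nu K P = 1 / p := by
    rw [hP, nu_mul (pow_ne_zero i hz0) (htz j), nu_pow hz0, hnu, hnut]
    have : (i : ℚ) * n + p * j = 1 := by exact_mod_cast hij
    field_simp
    linarith
  refine ⟨hdeg, ?_, ?_⟩
  · ext r
    rw [Set.mem_ofPred_eq, Set.mem_ofPred_eq, hdeg]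
    constructor
    · rintro ⟨x, hx, -, rfl⟩
      exact nu_mem_of_finrank_prime hdeg hx
    · rintro ⟨m, rfl⟩
      refine ⟨P ^ m, zpow_mem hPmem m, zpow_ne_zero m hP0, ?_⟩
      obtain ⟨k, rfl | rfl⟩ := m.eq_nat_or_neg
      · rw [zpow_natCast, nu_pow hP0, hnuP]; push_cast; ring
      · have h1 : nu K (P ^ k) + nu K (P ^ (-(k : ℤ))) = 0 := by
          rw [← nu_mul (pow_ne_zero k hP0) (zpow_ne_zero _ hP0), zpow_neg, zpow_natCast,
            mul_inv_cancel₀ (pow_ne_zero k hP0), ← map_one (algebraMap K Ks), nu_algebraMap]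
          simp [ord]
        rw [nu_pow hP0, hnuP] at h1
        push_cast
        linear_combination h1
  · obtain ⟨s, hs⟩ := exists_root_pow_pred (p := p) (Ks := Ks) Δ
    have hs0 : s ≠ 0 := by
      rintro rfl
      rw [zero_pow (Nat.sub_ne_zero_of_lt hp.one_lt)] at hs
      exact hΔ (by simpa using hs.symm)
    have hnus : nu K s = n / ((p : ℚ) - 1) := by
      have h := nu_pow (K := K) hs0 (p - 1)
      rw [hs, nu_algebraMap, hord, Nat.cast_sub hp.one_le] at h
      push_cast at h
      field_simp
      linarith
    have hroot : aeval (z + s) (minpoly K z) = 0 := by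
      rw [minpoly_parameter_root hn hΔ hord hz, aeval_parameterPoly, parameter_root_add hz hs,
        sub_self]
    let σ : IntermediateField.adjoin K {z} →ₐ[K] Ks :=
      (IntermediateField.algHomAdjoinIntegralEquiv K hint).symm
        ⟨z + s, by rw [mem_aroots]; exact ⟨minpoly.ne_zero hint, hroot⟩⟩
    have hσz : σ ⟨z, hmem⟩ = z + s :=
      IntermediateField.algHomAdjoinIntegralEquiv_symm_apply_gen K hint _
    refine ⟨σ, ?_, ⟨P, hPmem⟩, ?_, ?_⟩
    · intro h
      rw [h] at hσz
      exact hs0 (by simpa using hσz.symm)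
    · rw [nuOf, hdeg, hnuP]
      field_simp
    · have hPe : (⟨P, hPmem⟩ : IntermediateField.adjoin K {z}) =
          ⟨z, hmem⟩ ^ i * algebraMap K _ (t ^ j) := rfl
      have hσP : σ ⟨P, hPmem⟩ = (z + s) ^ i * algebraMap K Ks (t ^ j) := by
        rw [hPe, map_mul, map_pow, hσz, σ.commutes]
      have e : σ ⟨P, hPmem⟩ - P = P * ((1 + s / z) ^ i - 1) := by
        rw [hσP, hP, one_add_div hz0, div_pow]
        field_simp
      have hsz0 : s / z ≠ 0 := div_ne_zero hs0 hz0
      have hnusz : nu K (s / z) = b / p := by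
        have h := nu_mul (K := K) hsz0 hz0
        rw [div_mul_cancel₀ _ hz0, hnus, hnu] at h
        rw [hb]
        field_simp
        field_simp at h
        linarith
      have hvsz := (nu_eq_iff hsz0 _).1 hnusz
      have hlt : extVal K Ks (s / z) < 1 := by
        rw [hvsz]
        have := rpow_break_lt_one (p := p) (break_pos hn hb)
        convert this using 2
        push_cast
        ring
      have hv : extVal K Ks ((1 + s / z) ^ i - 1) = _ :=
        (map_one_add_pow_sub_one (p := p) (extVal K Ks) hlt hi).trans hvsz
      have hne : (1 + s / z) ^ i - 1 ≠ 0 := by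
        intro h
        rw [h, map_zero] at hv
        exact (NNReal.rpow_pos two_pos).ne hv
      rw [nuOf, hdeg, e, nu_mul hP0 hne, hnuP, (nu_eq_iff hne _).2 hv]
      field_simp
      ring

end Roots
end LocalFieldExt

namespace LocalFieldExt

/-! ### Power series rings as complete local domains. -/

section CompleteRing

/-- A complete local domain with principal maximal ideal and a coefficient field is a power series
ring. -/
theorem exists_powerSeries_equiv {A B : Type*} [Field A] [CommRing B] [IsDomain B] (I : Ideal B)
    [IsAdicComplete I B] (ι : A →+* B) {t : B} (ht : I = Ideal.span {t}) (ht0 : t ≠ 0)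
    (hι : ∀ x : B, ∃ a : A, x - ι a ∈ I) :
    ∃ e : PowerSeries A ≃+* B, e PowerSeries.X = t ∧ ∀ a : A, e (PowerSeries.C a) = ι a := by
  let : WithIdeal B := ⟨I⟩
  let : UniformSpace A := ⊥
  have hadic : IsAdic I := rfl
  have hc := hadic.isAdicComplete_iff.1 inferInstance
  have := hc.1
  have := hc.2
  have htI : t ∈ I := ht ▸ Ideal.mem_span_singleton_self t
  have hev : PowerSeries.HasEval t := by
    rw [PowerSeries.hasEval_def, IsTopologicallyNilpotent,
      hadic.hasBasis_nhds_zero.tendsto_right_iff]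
    intro k _
    filter_upwards [Filter.eventually_ge_atTop k] with m hm
    exact Ideal.pow_le_pow_right hm (Ideal.pow_mem_pow htI m)
  have hcont : Continuous ι := continuous_of_discreteTopology
  let f : PowerSeries A →+* B := PowerSeries.eval₂Hom hcont hev
  have hX : f PowerSeries.X = t := by
    simp [f, PowerSeries.coe_eval₂Hom]
  have hC : ∀ a, f (PowerSeries.C a) = ι a := by
    intro a
    simp [f, PowerSeries.coe_eval₂Hom]
  have hmap : (Ideal.span {PowerSeries.X}).map f = I := by
    rw [Ideal.map_span, Set.image_singleton, hX, ht]
  have hinj : Function.Injective f := by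
    rw [injective_iff_map_eq_zero]
    intro g hg
    by_contra hne
    obtain ⟨k, u, rfl⟩ := IsDiscreteValuationRing.eq_unit_mul_pow_irreducible hne
      (PowerSeries.X_irreducible (R := A))
    rw [map_mul, map_pow, hX] at hg
    exact mul_ne_zero (u.isUnit.map f).ne_zero (pow_ne_zero k ht0) hg
  -- By completeness it suffices to be surjective modulo `I`, where the representatives `ι a` do it.
  have hsurj : Function.Surjective f := by
    have : IsHausdorff ((Ideal.span {PowerSeries.X}).map f) B := by
      rw [hmap]; infer_instance
    refine surjective_of_mk_map_comp_surjective f (I := Ideal.span {PowerSeries.X}) ?_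
    intro y
    obtain ⟨x, rfl⟩ := Ideal.Quotient.mk_surjective y
    obtain ⟨a, ha⟩ := hι x
    refine ⟨PowerSeries.C a, ?_⟩
    rw [RingHom.comp_apply, hC, eq_comm, Ideal.Quotient.eq, hmap]
    exact ha
  exact ⟨RingEquiv.ofBijective f ⟨hinj, hsurj⟩, hX, hC⟩

end CompleteRing

/-! ### Hensel's lemma, Teichmüller representatives and automorphisms of `K`. -/

section Coefficients

variable {K : Type*} [Field K] [ValuativeRel K] [TopologicalSpace K]
  [IsNonarchimedeanLocalField K]

theorem valuation_le_one_iff_ord {x : K} (hx : x ≠ 0) :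
    ValuativeRel.valuation K x ≤ 1 ↔ 0 ≤ ord K x := by
  rw [← (valueEmbedding_strictMono K).le_iff_le, map_one, valueEmbedding_eq K hx,
    zpow_le_one_iff_right₀ one_lt_two, neg_nonpos]

theorem valuation_lt_one_iff_ord {x : K} (hx : x ≠ 0) :
    ValuativeRel.valuation K x < 1 ↔ 0 < ord K x := by
  rw [← (valueEmbedding_strictMono K).lt_iff_lt, map_one, valueEmbedding_eq K hx,
    zpow_lt_one_iff_right₀ one_lt_two, neg_lt_zero]

theorem mem_maximalIdeal_iff (x : 𝒪[K]) : x ∈ 𝓂[K] ↔ ValuativeRel.valuation K (x : K) < 1 := by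
  rw [IsLocalRing.mem_maximalIdeal, mem_nonunits_iff,
    Valuation.Integers.isUnit_iff_valuation_eq_one (Valuation.integer.integers _)]
  have h := x.2
  rw [Valuation.mem_integer_iff] at h
  exact (lt_iff_le_and_ne.trans (and_iff_right h)).symm

theorem isAdicComplete_integers : IsAdicComplete 𝓂[K] 𝒪[K] := by
  let := IsTopologicalAddGroup.rightUniformSpace K
  have := isUniformAddGroup_of_addCommGroup (G := K)
  infer_instance

theorem maximalIdeal_eq_span {t : 𝒪[K]} (ht0 : (t : K) ≠ 0) (ht : ord K (t : K) = 1) :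
    𝓂[K] = Ideal.span {t} := by
  ext x
  rw [Ideal.mem_span_singleton, mem_maximalIdeal_iff]
  by_cases hx : (x : K) = 0
  · have : x = 0 := Subtype.ext hx
    simp [this]
  constructor
  · intro h
    rw [valuation_lt_one_iff_ord hx] at h
    have hy : ValuativeRel.valuation K ((x : K) / t) ≤ 1 := by
      rw [valuation_le_one_iff_ord (div_ne_zero hx ht0), ord_div hx ht0, ht]
      omega
    refine ⟨⟨(x : K) / t, hy⟩, Subtype.ext ?_⟩
    change (x : K) = t * (x / t)
    field_simp
  · rintro ⟨y, rfl⟩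
    have h1 : ValuativeRel.valuation K (t : K) < 1 := by
      rw [valuation_lt_one_iff_ord ht0, ht]; exact one_pos
    have h2 : ValuativeRel.valuation K (y : K) ≤ 1 := y.2
    change ValuativeRel.valuation K ((t : K) * y) < 1
    rw [map_mul]
    exact mul_lt_one_of_lt_of_le h1 h2

theorem exists_root_of_simple_root (f : Polynomial 𝒪[K]) (hf : f.Monic) (a₀ : 𝒪[K])
    (h₁ : ValuativeRel.valuation K ((f.eval a₀ : 𝒪[K]) : K) < 1)
    (h₂ : ValuativeRel.valuation K ((f.derivative.eval a₀ : 𝒪[K]) : K) = 1) :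
    ∃ a : 𝒪[K], f.eval a = 0 ∧ ValuativeRel.valuation K ((a : K) - a₀) < 1 := by
  have := isAdicComplete_integers (K := K)
  obtain ⟨a, ha, h⟩ := HenselianRing.is_henselian (I := 𝓂[K]) f hf a₀
    ((mem_maximalIdeal_iff _).2 h₁) (IsUnit.map _ ((Valuation.Integers.isUnit_iff_valuation_eq_one
      (Valuation.integer.integers _)).2 h₂))
  exact ⟨a, ha, (mem_maximalIdeal_iff _).1 h⟩

variable {p : ℕ} [Fact p.Prime] [CharP K p]

omit [TopologicalSpace K] [IsNonarchimedeanLocalField K] in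
theorem valuation_natCast {m : ℕ} (hm : ¬ p ∣ m) : ValuativeRel.valuation K (m : K) = 1 := by
  have hne : (m : ZMod p) ≠ 0 := by rwa [Ne, ZMod.natCast_eq_zero_iff]
  have h := congrArg (fun z => ValuativeRel.valuation K (ZMod.castHom (dvd_refl p) K z))
    (ZMod.pow_card_sub_one_eq_one hne)
  simp only [map_pow, map_natCast, map_one] at h
  exact (pow_eq_one_iff_of_nonneg zero_le
    (Nat.sub_ne_zero_of_lt (Fact.out : p.Prime).one_lt)).1 h

/-- Principal units have roots of order prime to `p`. -/
theorem exists_pow_eq_of_one_unit {x : K} (hx : ValuativeRel.valuation K (x - 1) < 1) {m : ℕ}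
    (hm : ¬ p ∣ m) : ∃ w : K, w ^ m = x ∧ ValuativeRel.valuation K (w - 1) < 1 := by
  have hm0 : m ≠ 0 := fun h => hm (h ▸ dvd_zero p)
  have hx1 : ValuativeRel.valuation K x ≤ 1 := by
    have := Valuation.map_add_le _ hx.le (map_one (ValuativeRel.valuation K)).le
    rwa [sub_add_cancel] at this
  obtain ⟨w, hw, h⟩ := exists_root_of_simple_root
    (Polynomial.X ^ m - Polynomial.C (⟨x, hx1⟩ : 𝒪[K])) (Polynomial.monic_X_pow_sub_C _ hm0) 1
    (by
      rw [Polynomial.eval_sub, Polynomial.eval_pow, Polynomial.eval_X, Polynomial.eval_C, one_pow]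
      change ValuativeRel.valuation K (1 - x) < 1
      rwa [Valuation.map_sub_swap])
    (by
      simp only [Polynomial.derivative_sub, Polynomial.derivative_X_pow, Polynomial.derivative_C,
        sub_zero, Polynomial.eval_mul, Polynomial.eval_C, Polynomial.eval_pow, Polynomial.eval_X,
        one_pow, mul_one]
      have : ((m : 𝒪[K]) : K) = (m : K) := by simp
      rw [this]
      exact valuation_natCast hm)
  refine ⟨w, ?_, h⟩
  rw [Polynomial.eval_sub, Polynomial.eval_pow, Polynomial.eval_X, Polynomial.eval_C,
    sub_eq_zero] at hw
  exact congrArg Subtype.val hw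

variable (p K) in
theorem exists_card_residueField_eq : ∃ m : ℕ, m ≠ 0 ∧ Nat.card 𝓀[K] = p ^ m := by
  have := Fintype.ofFinite 𝓀[K]
  have h : ((Nat.card 𝓀[K] : ℕ) : 𝓀[K]) = 0 := by
    rw [Nat.card_eq_fintype_card]
    exact Nat.cast_card_eq_zero _
  have h2 : IsLocalRing.residue 𝒪[K] (Nat.card 𝓀[K] : 𝒪[K]) = 0 := by rwa [map_natCast]
  rw [IsLocalRing.residue_eq_zero_iff, mem_maximalIdeal_iff] at h2
  have h3 : (((Nat.card 𝓀[K] : ℕ) : 𝒪[K]) : K) = ((Nat.card 𝓀[K] : ℕ) : K) := by simp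
  rw [h3] at h2
  have hdvd : p ∣ Nat.card 𝓀[K] := by
    by_contra hm
    exact h2.ne (valuation_natCast hm)
  obtain ⟨l, hl⟩ := CharP.exists 𝓀[K]
  obtain ⟨m, hlp, hm⟩ := FiniteField.card 𝓀[K] l
  rw [Nat.card_eq_fintype_card, hm] at hdvd
  have hpl := (Nat.prime_dvd_prime_iff_eq Fact.out hlp).1 ((Fact.out : p.Prime).dvd_of_dvd_pow hdvd)
  exact ⟨m, m.ne_zero, by rw [Nat.card_eq_fintype_card, hm, hpl]⟩

variable (p K) in
include p in
theorem natCast_card_residueField : ((Nat.card 𝓀[K] : ℕ) : K) = 0 := by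
  obtain ⟨m, hm, h⟩ := exists_card_residueField_eq K p
  rw [h, Nat.cast_pow, CharP.cast_eq_zero, zero_pow hm]

include p in
/-- Teichmüller representatives. -/
theorem exists_teichmuller {x : K} (hx : ValuativeRel.valuation K x ≤ 1) :
    ∃ a : K, a ^ Nat.card 𝓀[K] = a ∧ ValuativeRel.valuation K (a - x) < 1 := by
  have := Fintype.ofFinite 𝓀[K]
  have hq : 1 < Nat.card 𝓀[K] := Finite.one_lt_card
  have hq0 : ((Nat.card 𝓀[K] : ℕ) : 𝒪[K]) = 0 := Subtype.ext (by
    simpa using natCast_card_residueField K p)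
  obtain ⟨w, hw, h⟩ := exists_root_of_simple_root
    (Polynomial.X ^ Nat.card 𝓀[K] - Polynomial.X : Polynomial 𝒪[K])
    (Polynomial.monic_X_pow_sub (by
      rw [Polynomial.degree_X]; exact_mod_cast hq)) ⟨x, hx⟩
    (by
      rw [← mem_maximalIdeal_iff, ← IsLocalRing.residue_eq_zero_iff]
      simp only [Polynomial.eval_sub, Polynomial.eval_pow, Polynomial.eval_X, map_sub, map_pow]
      rw [Nat.card_eq_fintype_card, FiniteField.pow_card, sub_self])
    (by
      rw [Polynomial.derivative_sub, Polynomial.derivative_X_pow, hq0]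
      simp)
  refine ⟨w, ?_, h⟩
  rw [Polynomial.eval_sub, Polynomial.eval_pow, Polynomial.eval_X, sub_eq_zero] at hw
  exact congrArg Subtype.val hw

theorem valuation_le_one_of_pow_eq {a : K} (ha : a ^ Nat.card 𝓀[K] = a) :
    ValuativeRel.valuation K a ≤ 1 := by
  have hq : 1 < Nat.card 𝓀[K] := Finite.one_lt_card
  by_contra! h
  have h1 := congrArg (ValuativeRel.valuation K) ha
  rw [map_pow] at h1
  exact (lt_self_pow₀ h hq).ne' h1

/-- The coefficient field of `K`, consisting of the Teichmüller representatives. -/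
def coefficientField (p : ℕ) [Fact p.Prime] (K : Type*) [Field K] [ValuativeRel K]
    [TopologicalSpace K] [IsNonarchimedeanLocalField K] [CharP K p] : Subfield K where
  carrier := {a | a ^ Nat.card 𝓀[K] = a}
  mul_mem' := fun {a b} ha hb => by
    simp only [Set.mem_ofPred_eq] at *
    rw [mul_pow, ha, hb]
  one_mem' := one_pow _
  zero_mem' := zero_pow Nat.card_pos.ne'
  -- The order of the residue field is a power of `p`, so raising to that power is additive.
  add_mem' := fun {a b} ha hb => by
    simp only [Set.mem_ofPred_eq] at *
    obtain ⟨m, -, hm⟩ := exists_card_residueField_eq K p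
    rw [hm] at ha hb ⊢
    rw [add_pow_char_pow, ha, hb]
  neg_mem' := fun {a} ha => by
    simp only [Set.mem_ofPred_eq] at *
    obtain ⟨m, -, hm⟩ := exists_card_residueField_eq K p
    rw [hm] at ha ⊢
    have h := sub_pow_char_pow (p := p) (n := m) (0 : K) a
    rw [zero_sub, ha, zero_pow (pow_ne_zero m (Fact.out : p.Prime).ne_zero), zero_sub] at h
    exact h
  inv_mem' := fun a ha => by
    simp only [Set.mem_ofPred_eq] at *
    rw [inv_pow, ha]

theorem mem_coefficientField {a : K} :
    a ∈ coefficientField p K ↔ a ^ Nat.card 𝓀[K] = a := Iff.rfl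

/-- Any two uniformizers are conjugate under an automorphism that is trivial on the residue
field. -/
theorem exists_automorphism (p : ℕ) [Fact p.Prime] [CharP K p] {t t' : K} (ht0 : t ≠ 0)
    (ht : ord K t = 1) (ht0' : t' ≠ 0) (ht' : ord K t' = 1) :
    ∃ φ : K ≃+* K, IsResiduallyTrivial φ ∧ φ t = t' ∧
      ∀ a : K, a ^ Nat.card 𝓀[K] = a → φ a = a := by
  have := isAdicComplete_integers (K := K)
  let ι : coefficientField p K →+* 𝒪[K] := (coefficientField p K).subtype.codRestrict
    (ValuativeRel.valuation K).integer fun a => valuation_le_one_of_pow_eq a.2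
  have hι : ∀ x : 𝒪[K], ∃ a, x - ι a ∈ 𝓂[K] := by
    intro x
    obtain ⟨a, ha, h⟩ := exists_teichmuller (p := p) x.2
    refine ⟨⟨a, ha⟩, (mem_maximalIdeal_iff _).2 ?_⟩
    rw [Valuation.map_sub_swap] at h
    exact h
  have hint : ∀ {s : K}, s ≠ 0 → ord K s = 1 → s ∈ 𝒪[K] := by
    intro s hs0 hs
    exact (valuation_le_one_iff_ord hs0).2 (by rw [hs]; exact zero_le_one)
  have hequiv : ∀ {s : K} (hs0 : s ≠ 0) (hs : ord K s = 1),
      ∃ e : PowerSeries (coefficientField p K) ≃+* 𝒪[K],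
        e PowerSeries.X = ⟨s, hint hs0 hs⟩ ∧ ∀ a, e (PowerSeries.C a) = ι a := fun hs0 hs =>
    exists_powerSeries_equiv 𝓂[K] ι (maximalIdeal_eq_span hs0 hs)
      (fun h => hs0 (congrArg Subtype.val h)) hι
  obtain ⟨e, heX, heC⟩ := hequiv ht0 ht
  obtain ⟨e', heX', heC'⟩ := hequiv ht0' ht'
  -- This substitutes `t'` for `t` in power series over the coefficient field.
  let f : 𝒪[K] ≃+* 𝒪[K] := e.symm.trans e'
  have hft : f ⟨t, hint ht0 ht⟩ = ⟨t', hint ht0' ht'⟩ := by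
    rw [← heX, ← heX']; simp [f]
  have hfι : ∀ a, f (ι a) = ι a := by
    intro a
    conv_lhs => rw [← heC]
    rw [← heC']; simp [f]
  let φ : K ≃+* K := IsFractionRing.ringEquivOfRingEquiv f
  have hφ : ∀ x : 𝒪[K], φ (x : K) = f x := fun x =>
    IsFractionRing.ringEquivOfRingEquiv_algebraMap (K := K) (L := K) f x
  refine ⟨φ, ?_, ?_, ?_⟩
  · rw [isResiduallyTrivial_iff]
    intro x hx
    obtain ⟨a, ha⟩ := hι ⟨x, hx⟩
    have h1 := ha
    rw [maximalIdeal_eq_span (t := ⟨t, hint ht0 ht⟩) ht0 ht, Ideal.mem_span_singleton] at h1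
    have h2 : f (⟨x, hx⟩ - ι a) ∈ 𝓂[K] := by
      rw [maximalIdeal_eq_span (t := ⟨t', hint ht0' ht'⟩) ht0' ht', Ideal.mem_span_singleton,
        ← hft]
      exact map_dvd f h1
    have h3 := Ideal.sub_mem _ h2 ha
    rw [map_sub, hfι, sub_sub_sub_cancel_right, mem_maximalIdeal_iff] at h3
    have h4 := hφ ⟨x, hx⟩
    change φ x = _ at h4
    rw [h4]
    exact h3
  · have := hφ ⟨t, hint ht0 ht⟩
    rw [hft] at this
    exact this
  · intro a ha
    have h1 := hφ (ι ⟨a, ha⟩)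
    rw [hfι] at h1
    exact h1

end Coefficients

end LocalFieldExt

namespace LocalFieldExt

/-! ### Counting classes modulo powers in a finite cyclic group. -/

section Counting

/-- The fibres of `F` are the cosets of the subgroup of `k`-th powers, whose index in a cyclic group
is the gcd. -/
theorem encard_range_of_eq_iff {G X : Type*} [CommGroup G] [Finite G] [IsCyclic G] {k : ℕ}
    (F : G → X) (hF : ∀ a b, F a = F b ↔ ∃ c, b = a * c ^ k) :
    (Set.range F).encard = (Nat.gcd (Nat.card G) k : ℕ∞) := by
  let N : Subgroup G := (powMonoidHom k : G →* G).range
  have hN : ∀ a b : G, (QuotientGroup.mk a : G ⧸ N) = QuotientGroup.mk b ↔ F a = F b := by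
    intro a b
    rw [QuotientGroup.eq, hF]
    constructor
    · rintro ⟨c, hc⟩
      exact ⟨c, by rw [← powMonoidHom_apply, hc, mul_inv_cancel_left]⟩
    · rintro ⟨c, rfl⟩
      exact ⟨c, by simp⟩
  let e : G ⧸ N → Set.range F := fun x => Quotient.liftOn' x (fun a => ⟨F a, a, rfl⟩) (by
    intro a b hab
    exact Subtype.ext ((hN a b).1 (Quotient.sound' hab)))
  have he : Function.Bijective e := by
    constructor
    · intro x y
      induction x using Quotient.inductionOn'
      induction y using Quotient.inductionOn'
      intro h
      exact (hN _ _).2 (congrArg Subtype.val h)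
    · rintro ⟨_, a, rfl⟩
      exact ⟨QuotientGroup.mk a, rfl⟩
  rw [Set.encard, ← ENat.card_congr (Equiv.ofBijective e he), ENat.card_eq_coe_natCard,
    ← IsCyclic.index_powMonoidHom_range]
  rfl

/-- The `l`-th powers form a cyclic group of order `Nat.card G / l`, and `c ^ (l * k)` is the `k`-th
power of its element `c ^ l`. -/
theorem encard_image_pow {G X : Type*} [CommGroup G] [Finite G] [IsCyclic G] {l k : ℕ}
    (hl : l ∣ Nat.card G) (F : G → X) (hF : ∀ a b, F a = F b ↔ ∃ c, b = a * c ^ (l * k)) :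
    (F '' {a | ∃ w, w ^ l = a}).encard = (Nat.gcd (Nat.card G / l) k : ℕ∞) := by
  let H : Subgroup G := (powMonoidHom l : G →* G).range
  have hH : Nat.card H = Nat.card G / l := by
    rw [IsCyclic.card_powMonoidHom_range, Nat.gcd_eq_right hl]
  have h := encard_range_of_eq_iff (G := H) (k := k) (fun a : H => F a) (by
    intro a b
    rw [hF]
    constructor
    · rintro ⟨c, hc⟩
      refine ⟨⟨c ^ l, c, rfl⟩, Subtype.ext ?_⟩
      simpa [← pow_mul] using hc
    · rintro ⟨⟨_, c, rfl⟩, hc⟩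
      refine ⟨c, ?_⟩
      simpa [← pow_mul] using congrArg Subtype.val hc)
  rw [← hH, ← h]
  congr 1
  ext x
  constructor
  · rintro ⟨a, ⟨w, hw⟩, rfl⟩
    exact ⟨⟨a, w, hw⟩, rfl⟩
  · rintro ⟨⟨a, w, hw⟩, rfl⟩
    exact ⟨a, ⟨w, hw⟩, rfl⟩

/-- An `(l * k)`-th power is an `l`-th power, so the two images are disjoint and the count is a
difference, with `gcd (|G|, l * k) = l * gcd (|G| / l, k)`. -/
theorem encard_image_compl_pow {G X : Type*} [CommGroup G] [Finite G] [IsCyclic G] {l k : ℕ}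
    (hl : l ∣ Nat.card G) (F : G → X) (hF : ∀ a b, F a = F b ↔ ∃ c, b = a * c ^ (l * k)) :
    (F '' {a | ∃ w, w ^ l = a}ᶜ).encard = ((l - 1) * Nat.gcd (Nat.card G / l) k : ℕ) := by
  have h1 := encard_range_of_eq_iff F hF
  have h2 := encard_image_pow hl F hF
  have hdisj : Disjoint (F '' {a | ∃ w, w ^ l = a}) (F '' {a | ∃ w, w ^ l = a}ᶜ) := by
    rw [Set.disjoint_left]
    rintro _ ⟨_, ⟨w, rfl⟩, rfl⟩ ⟨b, hb, hab⟩
    obtain ⟨c, hc⟩ := (hF _ _).1 hab.symm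
    exact hb ⟨w * c ^ k, by rw [mul_pow, hc, ← pow_mul, mul_comm k]⟩
  have hun : F '' {a | ∃ w, w ^ l = a} ∪ F '' {a | ∃ w, w ^ l = a}ᶜ = Set.range F := by
    rw [← Set.image_union, Set.union_compl_self, Set.image_univ]
  rw [← hun, Set.encard_union_eq hdisj, h2] at h1
  obtain ⟨m, hm⟩ := hl
  have hm0 : 0 < l * m := hm ▸ Nat.card_pos
  have hl0 : 0 < l := Nat.pos_of_mul_pos_right hm0
  have e : Nat.gcd (Nat.card G) (l * k) = l * Nat.gcd (Nat.card G / l) k := by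
    rw [hm, Nat.mul_div_cancel_left _ hl0, Nat.gcd_mul_left]
  rw [e] at h1
  have h3 : ((l * Nat.gcd (Nat.card G / l) k : ℕ) : ℕ∞) =
      (Nat.gcd (Nat.card G / l) k : ℕ∞) + ((l - 1) * Nat.gcd (Nat.card G / l) k : ℕ) := by
    rw [← Nat.cast_add]
    congr 1
    obtain ⟨l', rfl⟩ : ∃ l', l = l' + 1 := ⟨l - 1, by omega⟩
    rw [Nat.add_sub_cancel]
    ring
  rw [h3] at h1
  exact ENat.add_right_injective_of_ne_top (ENat.natCast_ne_top _) h1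

end Counting

/-! ### `k`-isomorphisms and the Galois property in terms of parameters. -/

section Isomorphism

variable {K : Type*} [Field K] [ValuativeRel K] [TopologicalSpace K]
  [IsNonarchimedeanLocalField K]

theorem IsResiduallyTrivial.valuation_map_le_one {φ : K ≃+* K} (hφ : IsResiduallyTrivial φ) {x : K}
    (hx : ValuativeRel.valuation K x ≤ 1) : ValuativeRel.valuation K (φ x) ≤ 1 :=
  (hφ ⟨x, hx⟩).1

theorem IsResiduallyTrivial.valuation_map_lt_one {φ : K ≃+* K} (hφ : IsResiduallyTrivial φ) {x : K}
    (hx : ValuativeRel.valuation K x < 1) : ValuativeRel.valuation K (φ x) < 1 := by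
  have h := Valuation.map_add_lt _ ((isResiduallyTrivial_iff φ).1 hφ x hx.le) hx
  rwa [sub_add_cancel] at h

theorem IsResiduallyTrivial.ord_map_of_ord_eq_zero {φ : K ≃+* K} (hφ : IsResiduallyTrivial φ)
    {x : K} (hx0 : x ≠ 0) (hx : ord K x = 0) : ord K (φ x) = 0 := by
  have hφx : φ x ≠ 0 := by simpa using hx0
  have h1 := hφ.valuation_map_le_one ((valuation_le_one_iff_ord hx0).2 hx.ge)
  have h2 := hφ.valuation_map_le_one ((valuation_le_one_iff_ord (inv_ne_zero hx0)).2 (by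
    rw [ord_inv, hx, neg_zero]))
  rw [valuation_le_one_iff_ord hφx] at h1
  rw [map_inv₀, valuation_le_one_iff_ord (inv_ne_zero hφx), ord_inv] at h2
  omega

theorem ord_unit_part {x t : K} (hx0 : x ≠ 0) (ht0 : t ≠ 0) (ht : ord K t = 1) :
    ord K (x / t ^ ord K x) = 0 := by
  rw [ord_div hx0 (zpow_ne_zero _ ht0), ord_zpow, ht, mul_one, sub_self]

/-- Units go to units, so `φ` multiplies orders by the constant `ord K (φ t)`. Applied to `φ.symm t`
this shows that the constant divides `1`, and it is positive since `φ` preserves the maximal ideal.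
-/
theorem IsResiduallyTrivial.ord_map {φ : K ≃+* K} (hφ : IsResiduallyTrivial φ)
    {x : K} (hx0 : x ≠ 0) : ord K (φ x) = ord K x := by
  obtain ⟨t, ht0, ht⟩ := exists_ord_eq K 1
  have key : ∀ {ψ : K ≃+* K} (hψ : IsResiduallyTrivial ψ) {y : K} (_ : y ≠ 0),
      ord K (ψ y) = ord K y * ord K (ψ t) := by
    intro ψ hψ y hy0
    have hu := hψ.ord_map_of_ord_eq_zero (div_ne_zero hy0 (zpow_ne_zero _ ht0))
      (ord_unit_part hy0 ht0 ht)
    rw [map_div₀, map_zpow₀, ord_div (by simpa using hy0) (zpow_ne_zero _ (by simpa using ht0)),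
      ord_zpow] at hu
    linarith
  have hpos : ∀ {ψ : K ≃+* K} (_ : IsResiduallyTrivial ψ), 0 < ord K (ψ t) := by
    intro ψ hψ
    rw [← valuation_lt_one_iff_ord (by simpa using ht0)]
    exact hψ.valuation_map_lt_one ((valuation_lt_one_iff_ord ht0).2 (by rw [ht]; exact one_pos))
  have h1 := key hφ (y := φ.symm t) (by simpa using ht0)
  rw [φ.apply_symm_apply, ht] at h1
  have h2 : ord K (φ t) = 1 := by
    have := Int.eq_one_or_neg_one_of_mul_eq_one' h1.symm
    have h3 := hpos hφ
    omega
  rw [key hφ hx0, h2, mul_one]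

variable {Ks : Type*} [Field Ks] [Algebra K Ks] {p : ℕ} [Fact p.Prime] {n : ℕ} (hn : ¬ p ∣ n)

include hn in
-- `φ` carries the minimal polynomial of `z₁` to that of `z₂`, so it extends to the root fields.
theorem kIsomorphic_adjoin [Algebra.IsAlgebraic K Ks] {φ : K ≃+* K} (hφ : IsResiduallyTrivial φ)
    {Δ₁ Δ₂ : K} {z₁ z₂ : Ks} (hΔ₁ : Δ₁ ≠ 0) (hord : ord K Δ₁ = n) (hΔ₂ : φ Δ₁ = Δ₂)
    (h₁ : z₁ ^ p = algebraMap K Ks Δ₁ * (z₁ + 1)) (h₂ : z₂ ^ p = algebraMap K Ks Δ₂ * (z₂ + 1)) :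
    KIsomorphic (IntermediateField.adjoin K {z₁}) (IntermediateField.adjoin K {z₂}) := by
  subst hΔ₂
  have hi₁ : IsIntegral K z₁ := Algebra.IsIntegral.isIntegral z₁
  have hi₂ : IsIntegral K z₂ := Algebra.IsIntegral.isIntegral z₂
  have hm₁ := minpoly_parameter_root hn hΔ₁ hord h₁
  have hm₂ := minpoly_parameter_root hn (by simpa using hΔ₁) ((hφ.ord_map hΔ₁).trans hord) h₂
  have hassoc : Associated ((minpoly K z₁).map (φ : K →+* K)) (minpoly K z₂) := by
    rw [hm₁, hm₂]
    simp [parameterPoly]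
  refine ⟨((IntermediateField.adjoinRootEquivAdjoin K hi₁).symm.toRingEquiv.trans
    (AdjoinRoot.mapRingEquiv φ _ _ hassoc)).trans
    (IntermediateField.adjoinRootEquivAdjoin K hi₂).toRingEquiv, φ, fun x => ?_, hφ⟩
  change IntermediateField.adjoinRootEquivAdjoin K hi₂ (AdjoinRoot.mapRingEquiv φ _ _ hassoc
    ((IntermediateField.adjoinRootEquivAdjoin K hi₁).symm (algebraMap K _ x))) = _
  rw [AlgEquiv.commutes, AdjoinRoot.algebraMap_eq, AdjoinRoot.coe_mapRingEquiv, AdjoinRoot.map_of]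
  exact (IntermediateField.adjoinRootEquivAdjoin K hi₂).commutes (φ x)

variable [CharP K p] [IsSepClosure K Ks] {b : ℚ} (hb : b = (n : ℚ) / ((p : ℚ) - 1))

include hn hb in
-- The image of `z₁` lies in `K(z₂)` and has parameter `φ Δ₁`, so `parameter_congr` compares two
-- parameters of one field.
theorem valuation_lt_one_of_kIsomorphic {Δ₁ Δ₂ : K} {z₁ z₂ : Ks} (hΔ₁ : Δ₁ ≠ 0) (hΔ₂ : Δ₂ ≠ 0)
    (hord₁ : ord K Δ₁ = n) (hord₂ : ord K Δ₂ = n)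
    (h₁ : z₁ ^ p = algebraMap K Ks Δ₁ * (z₁ + 1)) (h₂ : z₂ ^ p = algebraMap K Ks Δ₂ * (z₂ + 1))
    (h : KIsomorphic (IntermediateField.adjoin K {z₁}) (IntermediateField.adjoin K {z₂})) :
    ∃ φ : K ≃+* K, IsResiduallyTrivial φ ∧ ValuativeRel.valuation K (Δ₂ / φ Δ₁ - 1) < 1 := by
  obtain ⟨σ, φ, hσ, hφ⟩ := h
  have hn0 : 0 < n := Nat.pos_of_ne_zero fun h => hn (h ▸ dvd_zero p)
  refine ⟨φ, hφ, ?_⟩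
  have hmem := IntermediateField.mem_adjoin_simple_self K z₁
  have hmem₂ := IntermediateField.mem_adjoin_simple_self K z₂
  set w := σ ⟨z₁, hmem⟩ with hw
  have hw' : w ^ p = algebraMap K _ (φ Δ₁) * (w + 1) := by
    have e : (⟨z₁, hmem⟩ : IntermediateField.adjoin K {z₁}) ^ p =
        algebraMap K _ Δ₁ * (⟨z₁, hmem⟩ + 1) := Subtype.ext h₁
    rw [hw, ← map_pow, e, map_mul, hσ, map_add, map_one]
  have hw'' : (w : Ks) ^ p = algebraMap K Ks (φ Δ₁) * (w + 1) :=
    congrArg (algebraMap (IntermediateField.adjoin K {z₂}) Ks) hw'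
  exact parameter_congr hn hb (adjoin_mem_extensions hn hb hΔ₂ hord₂ h₂) hw'
    (z₂ := ⟨z₂, hmem₂⟩) (Subtype.ext h₂)
    (nu_parameter_root hn0 (by simpa using hΔ₁) ((hφ.ord_map hΔ₁).trans hord₁) hw'')
    (nu_parameter_root hn0 hΔ₂ hord₂ h₂)

include hn in
theorem isGalois_adjoin_iff {Δ : K} {z : Ks} (hΔ : Δ ≠ 0) (hord : ord K Δ = n)
    (hz : z ^ p = algebraMap K Ks Δ * (z + 1)) :
    IsGalois K (IntermediateField.adjoin K {z}) ↔ ∃ x : K, x ^ (p - 1) = Δ := by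
  have hp : p.Prime := Fact.out
  have hp1 : p - 1 ≠ 0 := Nat.sub_ne_zero_of_lt hp.one_lt
  have : CharP Ks p := charP_of_injective_algebraMap (algebraMap K Ks).injective p
  have hgal : IsGalois K Ks := IsSepClosure.isGalois
  have hdeg := finrank_adjoin_parameter_root hn hΔ hord hz
  have hmin := minpoly_parameter_root hn hΔ hord hz
  have hint : IsIntegral K z := Algebra.IsIntegral.isIntegral z
  have hmem := IntermediateField.mem_adjoin_simple_self K z
  have hnormal : IsGalois K (IntermediateField.adjoin K {z}) ↔
      Normal K (IntermediateField.adjoin K {z}) :=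
    ⟨fun h => h.to_normal, fun h => { to_isSeparable := inferInstance, to_normal := h }⟩
  rw [hnormal, IntermediateField.normal_iff_forall_fieldRange_le (L := Ks)]
  constructor
  · intro H
    obtain ⟨s, hs⟩ := exists_root_pow_pred (p := p) (Ks := Ks) Δ
    have hroot : Polynomial.aeval (z + s) (minpoly K z) = 0 := by
      rw [hmin, aeval_parameterPoly, parameter_root_add hz hs, sub_self]
    let σ : IntermediateField.adjoin K {z} →ₐ[K] Ks :=
      (IntermediateField.algHomAdjoinIntegralEquiv K hint).symm
        ⟨z + s, by rw [Polynomial.mem_aroots]; exact ⟨minpoly.ne_zero hint, hroot⟩⟩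
    have hσz : σ ⟨z, hmem⟩ = z + s :=
      IntermediateField.algHomAdjoinIntegralEquiv_symm_apply_gen K hint _
    have hzs : z + s ∈ IntermediateField.adjoin K {z} := H σ ⟨_, hσz⟩
    have hsL : s ∈ IntermediateField.adjoin K {z} := by
      simpa using sub_mem hzs hmem
    -- If `s` were not in `K` it would generate `L`, but its degree is at most `p - 1`.
    by_contra! hcon
    have hadj := adjoin_simple_eq_of_finrank_prime hdeg (x := ⟨s, hsL⟩) (by
      intro a ha
      have ha' : s = algebraMap K Ks a := congrArg Subtype.val ha
      refine hcon a ((algebraMap K Ks).injective ?_)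
      rw [map_pow, ← ha', hs])
    have hle : (minpoly K s).natDegree ≤ p - 1 := by
      have h1 : (Polynomial.X ^ (p - 1) - Polynomial.C Δ : Polynomial K) ≠ 0 :=
        (Polynomial.monic_X_pow_sub_C Δ hp1).ne_zero
      refine (Polynomial.natDegree_le_of_dvd (minpoly.dvd K s ?_) h1).trans_eq
        Polynomial.natDegree_X_pow_sub_C
      simp [hs]
    rw [← IntermediateField.adjoin.finrank (Algebra.IsIntegral.isIntegral s), hadj, hdeg] at hle
    have := hp.one_lt
    omega
  · rintro ⟨x, hx⟩ σ
    have hx0 : algebraMap K Ks x ≠ 0 := by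
      intro h
      have h0 : x = 0 := by simpa using h
      rw [h0, zero_pow hp1] at hx
      exact hΔ hx.symm
    have hxΔ : (algebraMap K Ks x) ^ (p - 1) = algebraMap K Ks Δ := by rw [← map_pow, hx]
    have hroot : (σ ⟨z, hmem⟩) ^ p = algebraMap K Ks Δ * (σ ⟨z, hmem⟩ + 1) := by
      have e : (⟨z, hmem⟩ : IntermediateField.adjoin K {z}) ^ p =
        algebraMap K _ Δ * (⟨z, hmem⟩ + 1) := Subtype.ext hz
      rw [← map_pow, e, map_mul, σ.commutes, map_add, map_one]
    have hσz : σ ⟨z, hmem⟩ ∈ IntermediateField.adjoin K {z} := by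
      -- The difference of two conjugates is a root of `X ^ p - Δ * X`, whose roots are the prime
      -- field multiples of `x`.
      have hprod := prod_sub_zmod_mul (p := p) (σ ⟨z, hmem⟩ - z) (algebraMap K Ks x)
      have hzero : (σ ⟨z, hmem⟩ - z) ^ p - algebraMap K Ks x ^ (p - 1) * (σ ⟨z, hmem⟩ - z) = 0 := by
        rw [sub_pow_char, hroot, hz, hxΔ]
        ring
      rw [hzero, Finset.prod_eq_zero_iff] at hprod
      obtain ⟨a, -, ha⟩ := hprod
      have e : σ ⟨z, hmem⟩ = z + algebraMap K Ks (ZMod.castHom (dvd_refl p) K a * x) := by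
        have hc : algebraMap K Ks (ZMod.castHom (dvd_refl p) K a) =
            ZMod.castHom (dvd_refl p) Ks a :=
          congrFun (congrArg DFunLike.coe (Subsingleton.elim
            ((algebraMap K Ks).comp (ZMod.castHom (dvd_refl p) K))
            (ZMod.castHom (dvd_refl p) Ks))) a
        rw [map_mul, hc]
        linear_combination ha
      rw [e]
      exact add_mem hmem (IntermediateField.algebraMap_mem _ _)
    have hrange : σ.fieldRange = IntermediateField.adjoin K {σ ⟨z, hmem⟩} := by
      have h1 : (⊤ : IntermediateField K (IntermediateField.adjoin K {z})) =
          IntermediateField.adjoin K {⟨z, hmem⟩} := IntermediateField.lift_injective _ (by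
        rw [IntermediateField.lift_top, IntermediateField.lift_adjoin_simple])
      rw [AlgHom.fieldRange_eq_map, h1, IntermediateField.adjoin_map, Set.image_singleton]
    rw [hrange, IntermediateField.adjoin_simple_le_iff]
    exact hσz

end Isomorphism

end LocalFieldExt

namespace LocalFieldExt

/-! ### Leading coefficients as Teichmüller units. -/

section CoefficientUnits

variable {K : Type*} [Field K] [ValuativeRel K] [TopologicalSpace K]
  [IsNonarchimedeanLocalField K] {p : ℕ} [Fact p.Prime] [CharP K p]

theorem ord_eq_zero_of_mem_coefficientField {a : K} (ha : a ∈ coefficientField p K) :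
    ord K a = 0 := by
  rw [mem_coefficientField] at ha
  have hq : 1 < Nat.card 𝓀[K] := Finite.one_lt_card
  have h := congrArg (ord K) ha
  rw [ord_pow] at h
  have h2 : ((Nat.card 𝓀[K] : ℤ) - 1) * ord K a = 0 := by linear_combination h
  rcases mul_eq_zero.1 h2 with h3 | h3
  · omega
  · exact h3

theorem eq_of_mem_coefficientField {a b : K} (ha : a ∈ coefficientField p K)
    (hb : b ∈ coefficientField p K) (h : ValuativeRel.valuation K (a - b) < 1) : a = b := by
  by_contra hne
  have h0 := sub_ne_zero.2 hne
  rw [valuation_lt_one_iff_ord h0, ord_eq_zero_of_mem_coefficientField (sub_mem ha hb)] at h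
  exact h.false

theorem ord_coe_unit (a : (coefficientField p K)ˣ) : ord K ((a : coefficientField p K) : K) = 0 :=
  ord_eq_zero_of_mem_coefficientField (a : coefficientField p K).2

theorem exists_unit_div_sub_one_lt {x : K} (hx0 : x ≠ 0) (hx : ord K x = 0) :
    ∃ a : (coefficientField p K)ˣ,
      ValuativeRel.valuation K (x / ((a : coefficientField p K) : K) - 1) < 1 := by
  obtain ⟨a, ha, h⟩ := exists_teichmuller (p := p) ((valuation_le_one_iff_ord hx0).2 hx.ge)
  have ha0 : a ≠ 0 := by
    rintro rfl
    rw [zero_sub, Valuation.map_neg, valuation_lt_one_iff_ord hx0, hx] at h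
    exact h.false
  refine ⟨Units.mk0 ⟨a, ha⟩ fun h => ha0 (congrArg Subtype.val h), ?_⟩
  change ValuativeRel.valuation K (x / a - 1) < 1
  have e : x / a - 1 = (x - a) / a := by field_simp
  rw [e, map_div₀, (valuation_eq_one_iff ha0).2 (ord_eq_zero_of_mem_coefficientField ha),
    div_one, Valuation.map_sub_swap]
  exact h

theorem eq_of_valuation_div_sub_one_lt {a b : (coefficientField p K)ˣ}
    (h : ValuativeRel.valuation K
      (((a : coefficientField p K) : K) / ((b : coefficientField p K) : K) - 1) < 1) : a = b := by
  have h1 := eq_of_mem_coefficientField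
    (div_mem (a : coefficientField p K).2 (b : coefficientField p K).2) (one_mem _) h
  have hb : ((b : coefficientField p K) : K) ≠ 0 := by simp
  exact Units.ext (Subtype.ext ((div_eq_one_iff_eq hb).1 h1))

variable (p K) in
theorem exists_bijective_coefficientField :
    ∃ f : coefficientField p K → 𝓀[K], Function.Bijective f := by
  refine ⟨fun a => IsLocalRing.residue 𝒪[K] ⟨a, valuation_le_one_of_pow_eq a.2⟩, ?_, ?_⟩
  · intro a b h
    rw [← sub_eq_zero, ← map_sub, IsLocalRing.residue_eq_zero_iff, mem_maximalIdeal_iff] at h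
    exact Subtype.ext (eq_of_mem_coefficientField a.2 b.2 h)
  · intro y
    obtain ⟨x, rfl⟩ := IsLocalRing.residue_surjective y
    obtain ⟨a, ha, h⟩ := exists_teichmuller (p := p) x.2
    refine ⟨⟨a, ha⟩, ?_⟩
    rw [← sub_eq_zero, ← map_sub, IsLocalRing.residue_eq_zero_iff, mem_maximalIdeal_iff]
    exact h

instance : Finite (coefficientField p K) := by
  obtain ⟨f, hf⟩ := exists_bijective_coefficientField K p
  exact Finite.of_injective f hf.1

variable (p K) in
theorem card_coefficientField_units : Nat.card (coefficientField p K)ˣ = Nat.card 𝓀[K] - 1 := by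
  obtain ⟨f, hf⟩ := exists_bijective_coefficientField K p
  rw [Nat.card_units, Nat.card_congr (Equiv.ofBijective f hf)]

variable (p K) in
theorem pred_dvd_card_residueField_pred : p - 1 ∣ Nat.card 𝓀[K] - 1 := by
  obtain ⟨m, -, hm⟩ := exists_card_residueField_eq K p
  simpa [hm] using Nat.sub_dvd_pow_sub_pow p 1 m

end CoefficientUnits

/-! ### Classification by leading coefficients. -/

section Classification

variable {K : Type*} [Field K] [ValuativeRel K] [TopologicalSpace K]
  [IsNonarchimedeanLocalField K] {p : ℕ} [Fact p.Prime] [CharP K p]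
  {Ks : Type*} [Field Ks] [Algebra K Ks] [IsSepClosure K Ks]
  {n : ℕ} (hn : ¬ p ∣ n) {b : ℚ} (hb : b = (n : ℚ) / ((p : ℚ) - 1))
  {t : K} (ht0 : t ≠ 0) (ht : ord K t = 1)

include ht0 ht in
theorem unit_mul_pow_ne_zero (D : (coefficientField p K)ˣ) (n : ℕ) :
    ((D : coefficientField p K) : K) * t ^ n ≠ 0 ∧
      ord K (((D : coefficientField p K) : K) * t ^ n) = n := by
  have hD : ((D : coefficientField p K) : K) ≠ 0 := by simp
  refine ⟨mul_ne_zero hD (pow_ne_zero n ht0), ?_⟩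
  rw [ord_mul hD (pow_ne_zero n ht0), ord_coe_unit, ord_pow, ht]
  ring

include hn ht0 ht in
/-- The leading coefficient of the parameter determines the `k`-isomorphism class. -/
theorem kIsomorphic_of_close {Δ : K} (hΔ : Δ ≠ 0) {D : (coefficientField p K)ˣ}
    (h : ValuativeRel.valuation K (Δ / (((D : coefficientField p K) : K) * t ^ n) - 1) < 1)
    {z₁ z₂ : Ks} (h₁ : z₁ ^ p = algebraMap K Ks (((D : coefficientField p K) : K) * t ^ n) * (z₁ + 1))
    (h₂ : z₂ ^ p = algebraMap K Ks Δ * (z₂ + 1)) :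
    KIsomorphic (IntermediateField.adjoin K {z₁}) (IntermediateField.adjoin K {z₂}) := by
  have := (IsSepClosure.isGalois (k := K) (K := Ks))
  -- With `w ^ n = Δ / (D * t ^ n)`, the automorphism `t ↦ w * t` sends `D * t ^ n` to `Δ`.
  obtain ⟨w, hw, hw1⟩ := exists_pow_eq_of_one_unit h hn
  have hn0 : n ≠ 0 := fun h => hn (h ▸ dvd_zero p)
  obtain ⟨h0, hord⟩ := unit_mul_pow_ne_zero ht0 ht D n
  have hw0 : w ≠ 0 := by
    rintro rfl
    rw [zero_pow hn0] at hw
    exact div_ne_zero hΔ h0 hw.symm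
  have hwv : ord K w = 0 := by
    rw [← valuation_eq_one_iff hw0]
    exact one_unit_value _ hw1
  obtain ⟨φ, hφ, hφt, hφA⟩ := exists_automorphism p ht0 ht (mul_ne_zero hw0 ht0)
    (by rw [ord_mul hw0 ht0, hwv, ht, zero_add])
  refine kIsomorphic_adjoin hn hφ h0 hord ?_ h₁ h₂
  rw [map_mul, map_pow, hφt, hφA _ (D : coefficientField p K).2, mul_pow, hw]
  field_simp

include hn hb ht0 ht in
-- A residually trivial `φ` fixes Teichmüller representatives, since it permutes the roots of `X ^ q
-- = X` without changing residues. So it acts on leading coefficients only through the residue `c`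
-- of `φ t / t`, and every `c` occurs.
theorem kIsomorphic_iff {a d : (coefficientField p K)ˣ} {z₁ z₂ : Ks}
    (h₁ : z₁ ^ p = algebraMap K Ks (((a : coefficientField p K) : K) * t ^ n) * (z₁ + 1))
    (h₂ : z₂ ^ p = algebraMap K Ks (((d : coefficientField p K) : K) * t ^ n) * (z₂ + 1)) :
    KIsomorphic (IntermediateField.adjoin K {z₁}) (IntermediateField.adjoin K {z₂}) ↔
      ∃ c, d = a * c ^ n := by
  have := (IsSepClosure.isGalois (k := K) (K := Ks))
  obtain ⟨ha0, hao⟩ := unit_mul_pow_ne_zero ht0 ht a n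
  obtain ⟨hd0, hdo⟩ := unit_mul_pow_ne_zero ht0 ht d n
  constructor
  · intro h
    obtain ⟨φ, hφ, hv⟩ := valuation_lt_one_of_kIsomorphic hn hb ha0 hd0 hao hdo h₁ h₂ h
    have hφA : φ ((a : coefficientField p K) : K) = (a : coefficientField p K) := by
      have hmem := (a : coefficientField p K).2
      refine eq_of_mem_coefficientField (p := p) ?_ hmem
        ((isResiduallyTrivial_iff φ).1 hφ _ (valuation_le_one_of_pow_eq hmem))
      rw [mem_coefficientField] at hmem ⊢
      rw [← map_pow, hmem]
    have hφt0 : φ t ≠ 0 := by simpa using ht0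
    obtain ⟨c, hc⟩ := exists_unit_div_sub_one_lt (p := p) (div_ne_zero hφt0 ht0)
      (by rw [ord_div hφt0 ht0, hφ.ord_map ht0, sub_self])
    refine ⟨c, eq_of_valuation_div_sub_one_lt ?_⟩
    have hc0 : ((c : coefficientField p K) : K) ≠ 0 := by simp
    have ha0' : ((a : coefficientField p K) : K) ≠ 0 := by simp
    have hcn := one_unit_pow (ValuativeRel.valuation K) hc n
    have hmul := one_unit_mul (ValuativeRel.valuation K) hv hcn
    convert hmul using 3
    rw [map_mul, map_pow, hφA, div_pow, div_pow]
    push_cast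
    field_simp
  · rintro ⟨c, rfl⟩
    have hc0 : ((c : coefficientField p K) : K) ≠ 0 := by simp
    obtain ⟨φ, hφ, hφt, hφA⟩ := exists_automorphism p ht0 ht (mul_ne_zero hc0 ht0)
      (by rw [ord_mul hc0 ht0, ord_coe_unit, ht, zero_add])
    refine kIsomorphic_adjoin hn hφ ha0 hao ?_ h₁ h₂
    rw [map_mul, map_pow, hφt, hφA _ (a : coefficientField p K).2]
    push_cast
    ring

include hn hb ht0 ht in
theorem exists_leading_coefficient {L : IntermediateField K Ks} (hL : L ∈ extensions K Ks p b) :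
    ∃ (D : (coefficientField p K)ˣ) (Δ : K) (z : Ks), Δ ≠ 0 ∧ ord K Δ = n ∧
      ValuativeRel.valuation K (Δ / (((D : coefficientField p K) : K) * t ^ n) - 1) < 1 ∧
      z ^ p = algebraMap K Ks Δ * (z + 1) ∧ L = IntermediateField.adjoin K {z} := by
  have := (IsSepClosure.isGalois (k := K) (K := Ks))
  obtain ⟨Δ, z, hΔ, hord, hz, hLz⟩ := exists_parameter hn hb hL
  obtain ⟨D, hD⟩ := exists_unit_div_sub_one_lt (p := p) (div_ne_zero hΔ (pow_ne_zero n ht0))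
    (by rw [ord_div hΔ (pow_ne_zero n ht0), hord, ord_pow, ht]; ring)
  refine ⟨D, Δ, z, hΔ, hord, ?_, hz, hLz⟩
  rwa [div_div, mul_comm (t ^ n)] at hD

include ht0 ht in
/-- An element of order `(p - 1) * c` is a `(p - 1)`-th power if and only if its leading coefficient
is a `(p - 1)`-th power. -/
theorem exists_pow_pred_iff {c : ℕ} {Δ : K} {D : (coefficientField p K)ˣ}
    (h : ValuativeRel.valuation K
      (Δ / (((D : coefficientField p K) : K) * t ^ ((p - 1) * c)) - 1) < 1) :
    (∃ x : K, x ^ (p - 1) = Δ) ↔ ∃ w, w ^ (p - 1) = D := by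
  have hp1 : p - 1 ≠ 0 := Nat.sub_ne_zero_of_lt (Fact.out : p.Prime).one_lt
  have hD0 : ((D : coefficientField p K) : K) ≠ 0 := by simp
  obtain ⟨h0, hord⟩ := unit_mul_pow_ne_zero ht0 ht D ((p - 1) * c)
  constructor
  · rintro ⟨x, rfl⟩
    have hx0 : x ≠ 0 := by
      rintro rfl
      rw [zero_pow hp1, zero_div, zero_sub, Valuation.map_neg, map_one] at h
      exact h.false
    have hq0 := div_ne_zero (pow_ne_zero (p - 1) hx0) h0
    have hv := one_unit_value _ h
    rw [valuation_eq_one_iff hq0, ord_div (pow_ne_zero _ hx0) h0, hord,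
      ord_pow] at hv
    have hxc : ord K x = c := by
      have h1 : ((p - 1 : ℕ) : ℤ) * (ord K x - c) = 0 := by push_cast at hv ⊢; linear_combination hv
      rcases mul_eq_zero.1 h1 with h2 | h2
      · exact absurd (by exact_mod_cast h2) hp1
      · linarith
    obtain ⟨w, hw⟩ := exists_unit_div_sub_one_lt (p := p) (div_ne_zero hx0 (pow_ne_zero c ht0))
      (by rw [ord_div hx0 (pow_ne_zero c ht0), hxc, ord_pow, ht]; ring)
    have hw0 : ((w : coefficientField p K) : K) ≠ 0 := by simp
    refine ⟨w, (eq_of_valuation_div_sub_one_lt ?_)⟩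
    have hdiv := one_unit_div (ValuativeRel.valuation K) h (one_unit_pow (ValuativeRel.valuation K) hw (p - 1))
    convert hdiv using 3
    rw [div_pow, div_pow, mul_comm (p - 1) c, pow_mul]
    push_cast
    field_simp
  · rintro ⟨w, rfl⟩
    -- The leading term is already a `(p - 1)`-th power, and the remaining one-unit has a root of
    -- order `p - 1`, which is prime to `p`.
    obtain ⟨e, he, -⟩ := exists_pow_eq_of_one_unit (p := p) h (m := p - 1)
      (Nat.not_dvd_of_pos_of_lt (Nat.pos_of_ne_zero hp1) (Nat.sub_lt (Fact.out : p.Prime).pos one_pos))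
    refine ⟨e * ((w : coefficientField p K) * t ^ c), ?_⟩
    rw [mul_pow, he, mul_pow, ← pow_mul, mul_comm c]
    push_cast at h0 ⊢
    field_simp

end Classification

end LocalFieldExt

/-! ### The three counts. -/

namespace LocalFieldExt

theorem encard_isomorphism_classes (p : ℕ) [Fact p.Prime]
    (K : Type*) [Field K] [ValuativeRel K] [TopologicalSpace K] [IsNonarchimedeanLocalField K]
    [CharP K p] (Ks : Type*) [Field Ks] [Algebra K Ks] [IsSepClosure K Ks]
    (b : ℚ) (n : ℕ) (hn : ¬ p ∣ n) (hb : b = (n : ℚ) / ((p : ℚ) - 1)) :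
    (classes K Ks p b).encard = (Nat.gcd (Nat.card 𝓀[K] - 1) n : ℕ∞) ∧
      ∀ c : ℕ, ¬ p ∣ c → b = (c : ℚ) →
        (galoisClasses K Ks p b).encard = (Nat.gcd ((Nat.card 𝓀[K] - 1) / (p - 1)) c : ℕ∞) ∧
          (nonGaloisClasses K Ks p b).encard =
            (((p - 2) * Nat.gcd ((Nat.card 𝓀[K] - 1) / (p - 1)) c : ℕ) : ℕ∞) := by
  have hp : p.Prime := Fact.out
  have hp1 : 0 < p - 1 := Nat.sub_pos_of_lt hp.one_lt
  obtain ⟨t, ht0, ht⟩ := exists_ord_eq K 1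
  have hroot : ∀ D : (coefficientField p K)ˣ, ∃ z : Ks,
      z ^ p = algebraMap K Ks (((D : coefficientField p K) : K) * t ^ n) * (z + 1) := fun D =>
    exists_root_parameterPoly (unit_mul_pow_ne_zero ht0 ht D n).1
  choose z hz using hroot
  let F : (coefficientField p K)ˣ → Quotient (kIsoSetoid K Ks) := fun D =>
    Quotient.mk (kIsoSetoid K Ks) (IntermediateField.adjoin K {z D})
  have hF : ∀ a d, F a = F d ↔ ∃ c, d = a * c ^ n := fun a d =>
    Quotient.eq.trans (kIsomorphic_iff hn hb ht0 ht (hz a) (hz d))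
  have hmem : ∀ D, IntermediateField.adjoin K {z D} ∈ extensions K Ks p b := fun D =>
    adjoin_mem_extensions hn hb (unit_mul_pow_ne_zero ht0 ht D n).1
      (unit_mul_pow_ne_zero ht0 ht D n).2 (hz D)
  have hclass : ∀ L ∈ extensions K Ks p b, ∃ D Δ, F D = Quotient.mk _ L ∧
      ValuativeRel.valuation K (Δ / (((D : coefficientField p K) : K) * t ^ n) - 1) < 1 ∧
      (IsGalois K L ↔ ∃ x : K, x ^ (p - 1) = Δ) := by
    intro L hL
    obtain ⟨D, Δ, y, hΔ, hord, hclose, hy, rfl⟩ := exists_leading_coefficient hn hb ht0 ht hL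
    exact ⟨D, Δ, Quotient.sound (kIsomorphic_of_close hn ht0 ht hΔ hclose (hz D) hy), hclose,
      isGalois_adjoin_iff hn hΔ hord hy⟩
  refine ⟨?_, fun c hc hbc => ?_⟩
  · rw [← card_coefficientField_units K p, ← encard_range_of_eq_iff F hF]
    congr 1
    ext X
    constructor
    · rintro ⟨L, hL, rfl⟩
      obtain ⟨D, -, h, -⟩ := hclass L hL
      exact ⟨D, h⟩
    · rintro ⟨D, rfl⟩
      exact ⟨_, hmem D, rfl⟩
  -- The exponent in `hF` now splits as `l * k` with `l = p - 1` and `k = c`, the form required by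
  -- the counting lemmas.
  · obtain rfl : n = (p - 1) * c := by
      have h1 : (p : ℚ) - 1 ≠ 0 := by
        rw [sub_ne_zero]
        exact_mod_cast hp.ne_one
      have h2 : (n : ℚ) = ((p - 1 : ℕ) : ℚ) * c := by
        rw [Nat.cast_sub hp.one_le, Nat.cast_one, ← hbc, hb]
        field_simp
      exact_mod_cast h2
    have hdvd : p - 1 ∣ Nat.card (coefficientField p K)ˣ := by
      rw [card_coefficientField_units]
      exact pred_dvd_card_residueField_pred K p
    have hgal : ∀ D, IsGalois K (IntermediateField.adjoin K {z D}) ↔ ∃ w, w ^ (p - 1) = D := by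
      intro D
      obtain ⟨h0, hord⟩ := unit_mul_pow_ne_zero ht0 ht D ((p - 1) * c)
      rw [isGalois_adjoin_iff hn h0 hord (hz D)]
      refine exists_pow_pred_iff (c := c) ht0 ht ?_
      rw [div_self h0, sub_self, map_zero]
      exact zero_lt_one
    rw [← card_coefficientField_units K p]
    constructor
    · rw [← encard_image_pow hdvd F hF]
      congr 1
      ext X
      constructor
      · rintro ⟨L, ⟨hL, hLg⟩, rfl⟩
        obtain ⟨D, Δ, h, hclose, hiff⟩ := hclass L hL
        exact ⟨D, (exists_pow_pred_iff ht0 ht hclose).1 (hiff.1 hLg), h⟩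
      · rintro ⟨D, hD, rfl⟩
        exact ⟨_, ⟨hmem D, (hgal D).2 hD⟩, rfl⟩
    · have h := encard_image_compl_pow hdvd F hF
      -- The factor `l - 1` is `p - 1 - 1 = p - 2`.
      rw [Nat.sub_sub] at h
      rw [← h]
      congr 1
      ext X
      constructor
      · rintro ⟨L, ⟨hL, hLg⟩, rfl⟩
        obtain ⟨D, Δ, h, hclose, hiff⟩ := hclass L hL
        exact ⟨D, fun hD => hLg (hiff.2 ((exists_pow_pred_iff ht0 ht hclose).2 hD)), h⟩
      · rintro ⟨D, hD, rfl⟩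
        exact ⟨_, ⟨hmem D, fun hg => hD ((hgal D).1 hg)⟩, rfl⟩

end LocalFieldExt

theorem corollary2 (p : ℕ) [Fact p.Prime]
    (K : Type*) [Field K] [ValuativeRel K] [TopologicalSpace K] [IsNonarchimedeanLocalField K]
    [CharP K p] (Ks : Type*) [Field Ks] [Algebra K Ks] [IsSepClosure K Ks]
    (q : ℕ) (hq : Nat.card 𝓀[K] = q)
    (b : ℚ) (n : ℕ) (hn : ¬ p ∣ n) (hb : b = (n : ℚ) / ((p : ℚ) - 1)) :
    -- here `n = (p - 1) b`
    (LocalFieldExt.classes K Ks p b).encard = (Nat.gcd (q - 1) n : ℕ∞) ∧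
      ∀ c : ℕ, ¬ p ∣ c → b = (c : ℚ) →
        (LocalFieldExt.galoisClasses K Ks p b).encard = (Nat.gcd ((q - 1) / (p - 1)) c : ℕ∞) ∧
          (LocalFieldExt.nonGaloisClasses K Ks p b).encard =
            (((p - 2) * Nat.gcd ((q - 1) / (p - 1)) c : ℕ) : ℕ∞) := by
  subst hq
  exact LocalFieldExt.encard_isomorphism_classes p K Ks b n hn hb
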